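/- **Local Brunn–Minkowski inequality.** Let $n\ge 1$ and let $K\subset\mathbb{R}^n$ be a convex body with the origin in its interior whose boundary is a $C^\infty$ hypersurface with strictly positive curvature ($K\in\mathcal{K}^\infty_+$). Let $h=h_K(y)=\max_{x\in K}\langle y,x\rangle$ be its support function and, on the unit sphere $S^{n-1}$ (parametrizing $\partial K$ by the outer unit normal $\theta$), for a $1$-homogeneous function $F$ let $D^2F$ denote the restriction of its Euclidean Hessian to the tangent spaces $\theta^\perp$. Put $$g_K=\frac{D^2h}{h},\qquad \Delta_K f=\big((D^2h)^{-1}\big)^{ij}D^2_{ij}(fh)-(n-1)f,\qquad |\mathrm{grad}_{g_K}f|^2=g_K^{ij}f_if_j ,$$ where $fh$ is extended as a $1$-homogeneous function, and let $\nu_K$ be the centro-affine volume measure, whose density with respect to the Lebesgue measure of $S^{n-1}$ at $\theta$ is $|\mathrm{Det}(dx(e_1),\dots,dx(e_{n-1}),x)|$, with $x=\nabla h(\theta)$ and $e_1,\dots,e_{n-1}$ an orthonormal basis of $\theta^\perp$. Then for every $f\in C^2(S^{n-1})$ the integrals below converge and $$\int(\Delta_Kf)^2\,d\nu_K\;\ge\;(n-1)\int|\mathrm{grad}_{g_K}f|^2\,d\nu_K,\qquad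 \int|\mathrm{grad}_{g_K}f|^2\,d\nu_K=\int(-\Delta_Kf)\,f\,d\nu_K .$$ Moreover, for $n\ge2$, the (equivalent) spectral statement $\lambda_1(-\Delta_K)\ge n-1$ holds, where $\lambda_1(-\Delta_K)$ is the first non-zero eigenvalue of the unique self-adjoint extension in $L^2(\nu_K)$ (the closure) of the operator $-\Delta_K$ defined on $C^2(S^{n-1})$. -/

import Mathlib

open MeasureTheory Metric Filter Topology
open scoped ContDiff Manifold

noncomputable section

namespace CentroAffine

/-- The Euclidean space `ℝⁿ` of dimension `n = m + 1`, identified with its dual by the inner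
product. -/
abbrev Euc (m : ℕ) : Type := EuclideanSpace ℝ (Fin (m + 1))

/-- The Euclidean unit sphere of `ℝⁿ`, of dimension `m = n - 1`. -/
abbrev Sph (m : ℕ) : Type := sphere (0 : Euc m) 1

/-- The class `𝒦^∞_+` of convex bodies with the origin in the interior, whose boundary is a
`C^∞` hypersurface with strictly positive curvature. Near each boundary point `p` the body is a
sublevel set `{φ ≤ 0}` of a smooth function `φ` that is regular at `p`; the second fundamental form
of the boundary at `p` with respect to the outer unit normal `∇φ / |∇φ|` is the restriction of
`D²φ / |∇φ|` to the tangent space `ker dφ`, and it has to be positive definite. -/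
structure IsSmoothStronglyConvex {m : ℕ} (K : ConvexBody (Euc m)) : Prop where
  zero_mem_interior : (0 : Euc m) ∈ interior (K : Set (Euc m))
  boundary : ∀ p ∈ frontier (K : Set (Euc m)), ∃ (U : Set (Euc m)) (φ : Euc m → ℝ),
    IsOpen U ∧ p ∈ U ∧ ContDiffOn ℝ ∞ φ U ∧ fderiv ℝ φ p ≠ 0 ∧
    (K : Set (Euc m)) ∩ U = {x ∈ U | φ x ≤ 0} ∧
    ∀ v : Euc m, v ≠ 0 → fderiv ℝ φ p v = 0 → 0 < fderiv ℝ (fderiv ℝ φ) p v v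

/-- The support function `h_K(y) = max_{x ∈ K} ⟨y, x⟩`. -/
def supportFun {m : ℕ} (K : ConvexBody (Euc m)) (y : Euc m) : ℝ :=
  sSup ((fun x : Euc m => inner ℝ y x) '' (K : Set (Euc m)))

/-- The `0`-homogeneous extension `y ↦ f (y / |y|)` of a function on the sphere to
`ℝⁿ ∖ {0}` (with the value `0` at the origin). -/
def homExt {m : ℕ} (f : Sph m → ℝ) (y : Euc m) : ℝ :=
  if hy : y = 0 then 0
  else f ⟨‖y‖⁻¹ • y, by
    rw [mem_sphere_zero_iff_norm, norm_smul, norm_inv, norm_norm,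
      inv_mul_cancel₀ (norm_ne_zero_iff.mpr hy)]⟩

/-- A Euclidean orthonormal basis `e₁, …, e_{n-1}` of the tangent space `θ^⊥` of the sphere at `θ`.
The quantities below do not depend on which one is taken. -/
def frame {m : ℕ} (θ : Sph m) (i : Fin m) : Euc m :=
  haveI := Fact.mk (finrank_euclideanSpace_fin (𝕜 := ℝ) (n := m + 1))
  ((OrthonormalBasis.fromOrthogonalSpanSingleton (𝕜 := ℝ) m
    (ne_zero_of_mem_unit_sphere θ) i : (Submodule.span ℝ {(θ : Euc m)})ᗮ) : Euc m)

/-- For a `1`-homogeneous function `F` on `ℝⁿ`, the matrix `D²_{ij} F` at `θ`: the Euclidean second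
derivative of `F` restricted to the tangent space `θ^⊥`, in the frame. -/
def hessMatrix {m : ℕ} (F : Euc m → ℝ) (θ : Sph m) : Matrix (Fin m) (Fin m) ℝ :=
  Matrix.of fun i j => fderiv ℝ (fderiv ℝ F) (θ : Euc m) (frame θ i) (frame θ j)

/-- The matrix of the centro-affine metric `g_K = D² h_K / h_K` on the sphere. -/
def metric {m : ℕ} (K : ConvexBody (Euc m)) (θ : Sph m) : Matrix (Fin m) (Fin m) ℝ :=
  (supportFun K (θ : Euc m))⁻¹ • hessMatrix (supportFun K) θ

/-- The components `f_i = df(e_i)` of the differential of a function on the sphere. -/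
def diffVec {m : ℕ} (f : Sph m → ℝ) (θ : Sph m) (i : Fin m) : ℝ :=
  fderiv ℝ (homExt f) (θ : Euc m) (frame θ i)

/-- The squared length `|grad_{g_K} f|² = g_K^{ij} f_i f_j` of the `g_K`-gradient. -/
def gradSq {m : ℕ} (K : ConvexBody (Euc m)) (f : Sph m → ℝ) (θ : Sph m) : ℝ :=
  diffVec f θ ⬝ᵥ ((metric K θ)⁻¹.mulVec (diffVec f θ))

/-- The Hilbert--Brunn--Minkowski operator (the centro-affine Laplacian)
`Δ_K f = ((D² h_K)⁻¹)^{ij} D²_{ij}(f h_K) - (n - 1) f`, where `f h_K` is extended from the sphere as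
a `1`-homogeneous function. -/
def laplacian {m : ℕ} (K : ConvexBody (Euc m)) (f : Sph m → ℝ) (θ : Sph m) : ℝ :=
  ((hessMatrix (supportFun K) θ)⁻¹ *
    hessMatrix (fun y => homExt f y * supportFun K y) θ).trace - (m : ℝ) * f θ

/-- The density at `θ` of the centro-affine volume measure:
`|Det(dx(e₁), …, dx(e_{n-1}), x)|`, where `x = ∇h_K` is the parametrization of `∂K` by its outer
unit normal `θ`. -/
def volDensity {m : ℕ} (K : ConvexBody (Euc m)) (θ : Sph m) : ℝ :=
  |(EuclideanSpace.basisFun (Fin (m + 1)) ℝ).toBasis.det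
    (Fin.snoc (α := fun _ => Euc m)
      (fun i => fderiv ℝ (gradient (supportFun K)) (θ : Euc m) (frame θ i))
      (gradient (supportFun K) (θ : Euc m)))|

/-- The centro-affine volume measure `ν_K`, given by its density with respect to the Lebesgue
(surface) measure of the unit sphere. -/
def volMeasure {m : ℕ} (K : ConvexBody (Euc m)) : Measure (Sph m) :=
  ((volume : Measure (Euc m)).toSphere).withDensity fun θ => ENNReal.ofReal (volDensity K θ)

/-- `f ∈ C²` on the unit sphere. -/
def IsC2 {m : ℕ} (f : Sph m → ℝ) : Prop :=
  ContMDiff (𝓡 m) 𝓘(ℝ, ℝ) 2 f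

/-- `lam` is an eigenvalue of the unique self-adjoint extension in `L²(ν_K)` of `-Δ_K` on `C²`. This
extension is the closure of the operator: `u` belongs to its domain and is sent to `lam u` if and
only if there are `f_k ∈ C²` with `f_k → u` and `-Δ_K f_k → lam u` in `L²(ν_K)`. -/
def IsEigenvalue {m : ℕ} (K : ConvexBody (Euc m)) (lam : ℝ) : Prop :=
  ∃ u : Sph m → ℝ, MemLp u 2 (volMeasure K) ∧ ¬ (u =ᵐ[volMeasure K] 0) ∧
    ∃ f : ℕ → Sph m → ℝ, (∀ k, IsC2 (f k)) ∧
      Tendsto (fun k => eLpNorm (fun θ => f k θ - u θ) 2 (volMeasure K)) atTop (𝓝 0) ∧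
      Tendsto (fun k => eLpNorm (fun θ => -laplacian K (f k) θ - lam * u θ) 2 (volMeasure K))
        atTop (𝓝 0)

/-- The first non-zero eigenvalue `λ₁(-Δ_K)`. -/
def firstEigenvalue {m : ℕ} (K : ConvexBody (Euc m)) : ℝ :=
  sInf {lam : ℝ | lam ≠ 0 ∧ IsEigenvalue K lam}

end CentroAffine

end

/-! ### The Prékopa–Leindler and Brunn–Minkowski inequalities -/

namespace CentroAffine

open scoped ENNReal

/-! The inequality is the second variation of the Brunn–Minkowski inequality. Write `m = n - 1`, `h
= h_K`, `z = f h`, and let `V(t) = ∫ (h + t z) det D²(h + t z)` over the sphere, which is `n` times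
the volume of the body with support function `h + t z`. Brunn–Minkowski for midpoints gives `V(t)
V(-t) ≤ V(0)²` (`coneVol_mul_coneVol_le`), so `V'(0) = 0` forces `V''(0) ≤ 0`.

The density of `ν_K` is `h det D²h`. Hence `V'(0) = n ∫ z det D²h = n ∫ f dν_K`, and `V''(0) = n ∫ z
det(D²h) tr((D²h)⁻¹ D²z) = n ∫ f (Δ_K f + m f) dν_K`. This is the Poincaré inequality `m ∫ f² ≤ ∫
(-Δ_K f) f` for `f` of mean zero (`integral_mul_laplacian_le`).

The formula for `V'` needs no integration by parts. For admissible `k`, comparing Wulff shapes gives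
`V(k) ≤ ∫ h det D²h (k / h)ⁿ` with equality at `k = h`, so both sides have the same derivative there
(`integral_coneDensityDeriv`). Equating this with the derivative given by the product rule yields `∫
Δ_K f dν_K = 0`. Applied to `f²`, with `Δ_K(f²) = 2 f Δ_K f + 2 |grad f|²`, it becomes Green's
identity (`integral_gradSq`).

For the square of the Laplacian, let `g` be `f` minus its mean, expand `0 ≤ ∫ (Δ_K f + m g)²` and
use the Poincaré inequality for `g` (`local_brunnMinkowski`). The inequalities pass to `L²` limits
and bound the nonzero eigenvalues of the closure from below; linear functions divided by `h` show
that `m` is an eigenvalue. That `h_K` is `C²` with positive tangential Hessian follows from the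
inverse function theorem for the contact points of `K` with its supporting hyperplanes
(`isAdmissible_supportFun`). -/

theorem volume_add_volume_le_of_isCompact {A B C : Set ℝ} (hA : IsCompact A) (hB : IsCompact B)
    (hA0 : A.Nonempty) (hB0 : B.Nonempty) (hC : ∀ x ∈ A, ∀ y ∈ B, (1 / 2 : ℝ) * (x + y) ∈ C) :
    volume A + volume B ≤ 2 * volume C := by
  obtain ⟨a, ha, hamax⟩ := hA.exists_isGreatest hA0
  obtain ⟨b, hb, hbmin⟩ := hB.exists_isLeast hB0
  -- With `a = max A` and `b = min B`, the translates `A + b` and `a + B` both lie in `2C` and meet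
  -- at most in the point `a + b`.
  set A' : Set ℝ := (fun x => x + b) '' A
  set B' : Set ℝ := (fun x => a + x) '' B
  have hAv : volume A' = volume A := by
    simp [A', measure_preimage_add_right]
  have hBv : volume B' = volume B := by
    simp [B', measure_preimage_add]
  have hB'm : MeasurableSet B' := (hB.image (by fun_prop)).measurableSet
  have hdisj : AEDisjoint volume A' B' := by
    refine measure_mono_null (t := {a + b}) ?_ (by simp)
    rintro _ ⟨⟨x, hx, rfl⟩, ⟨y, hy, h⟩⟩
    have h1 := hamax hx
    have h2 := hbmin hy
    simp only [Set.mem_singleton_iff] at *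
    linarith
  have hsub : A' ∪ B' ⊆ (fun x => (2 : ℝ)⁻¹ * x) ⁻¹' C := by
    rintro _ (⟨x, hx, rfl⟩ | ⟨y, hy, rfl⟩)
    · have := hC x hx b hb
      simpa using this
    · have := hC a ha y hy
      simpa using this
  calc volume A + volume B = volume A' + volume B' := by rw [hAv, hBv]
    _ = volume (A' ∪ B') := (measure_union₀ hB'm.nullMeasurableSet hdisj).symm
    _ ≤ volume ((fun x => (2 : ℝ)⁻¹ * x) ⁻¹' C) := measure_mono hsub
    _ = 2 * volume C := by
      rw [Real.volume_preimage_mul_left (by norm_num)]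
      norm_num

/-- The one-dimensional Brunn--Minkowski inequality, for the midpoint set. -/
theorem volume_add_volume_le {A B C : Set ℝ} (hA : MeasurableSet A) (hB : MeasurableSet B)
    (hA0 : A.Nonempty) (hB0 : B.Nonempty) (hC : ∀ x ∈ A, ∀ y ∈ B, (1 / 2 : ℝ) * (x + y) ∈ C) :
    volume A + volume B ≤ 2 * volume C := by
  obtain ⟨a, ha⟩ := hA0
  obtain ⟨b, hb⟩ := hB0
  have key : ∀ K ⊆ A, IsCompact K → ∀ L ⊆ B, IsCompact L → volume K + volume L ≤ 2 * volume C := by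
    intro K hKA hK L hLB hL
    refine le_trans (add_le_add (measure_mono (Set.subset_insert a K))
      (measure_mono (Set.subset_insert b L))) ?_
    refine volume_add_volume_le_of_isCompact (hK.insert a) (hL.insert b) (by simp) (by simp) ?_
    exact fun x hx y hy => hC x (Set.insert_subset ha hKA hx) y (Set.insert_subset hb hLB hy)
  refine le_of_forall_lt fun r hr => ?_
  -- Inner regularity needs a bound strictly below the measure. A null set admits none, hence the
  -- alternatives `p = 0` and `q = 0`.
  obtain ⟨p, q, hp, hq, hpq⟩ : ∃ p q : ℝ≥0∞, (p < volume A ∨ p = 0) ∧ (q < volume B ∨ q = 0) ∧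
      r < p + q := by
    rcases eq_or_ne (volume A) 0 with hA1 | hA1
    · rw [hA1, zero_add] at hr
      obtain ⟨q, hq1, hq2⟩ := exists_between hr
      exact ⟨0, q, Or.inr rfl, Or.inl hq2, by simpa using hq1⟩
    rcases eq_or_ne (volume B) 0 with hB1 | hB1
    · rw [hB1, add_zero] at hr
      obtain ⟨q, hq1, hq2⟩ := exists_between hr
      exact ⟨q, 0, Or.inl hq2, Or.inr rfl, by simpa using hq1⟩
    obtain ⟨p, hp, q, hq, h⟩ := ENNReal.exists_lt_add_of_lt_add hr hA1 hB1
    exact ⟨p, q, Or.inl hp, Or.inl hq, h⟩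
  have hK : ∃ K ⊆ A, IsCompact K ∧ p ≤ volume K := by
    rcases hp with hp | rfl
    · obtain ⟨K, h1, h2, h3⟩ := hA.exists_lt_isCompact hp
      exact ⟨K, h1, h2, h3.le⟩
    · exact ⟨∅, by simp, isCompact_empty, by simp⟩
  have hL : ∃ K ⊆ B, IsCompact K ∧ q ≤ volume K := by
    rcases hq with hp | rfl
    · obtain ⟨K, h1, h2, h3⟩ := hB.exists_lt_isCompact hp
      exact ⟨K, h1, h2, h3.le⟩
    · exact ⟨∅, by simp, isCompact_empty, by simp⟩
  obtain ⟨K, h1, h2, h3⟩ := hK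
  obtain ⟨L, h4, h5, h6⟩ := hL
  exact hpq.trans_le ((add_le_add h3 h6).trans (key K h1 h2 L h4 h5))

theorem lintegral_eq_lintegral_superlevel {f : ℝ → ℝ≥0∞} (hf : Measurable f) (h1 : ∀ x, f x ≤ 1) :
    ∫⁻ x, f x = ∫⁻ t in Set.Ioo (0 : ℝ) 1, volume {x | ENNReal.ofReal t < f x} := by
  have hfin : ∀ x, f x ≠ ⊤ := fun x => ((h1 x).trans_lt ENNReal.one_lt_top).ne
  have h := lintegral_eq_lintegral_meas_lt volume (f := fun x => (f x).toReal)
    (ae_of_all _ fun x => ENNReal.toReal_nonneg) hf.ennreal_toReal.aemeasurable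
  simp only [ENNReal.ofReal_toReal (hfin _)] at h
  rw [h, ← Set.Ioo_union_Ici_eq_Ioi (zero_lt_one (α := ℝ)),
    lintegral_union measurableSet_Ici (by
      rw [Set.disjoint_left]; intro x hx hx'; exact absurd hx.2 (not_lt.mpr hx'))]
  have h0 : ∫⁻ t in Set.Ici (1 : ℝ), volume {a | t < (f a).toReal} = 0 := by
    rw [setLIntegral_congr_fun (g := fun _ => 0) measurableSet_Ici, lintegral_zero]
    intro t ht
    have : {a | t < (f a).toReal} = ∅ := by
      ext a
      simp only [Set.mem_ofPred_eq, Set.mem_empty_iff_false, iff_false, not_lt]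
      exact (ENNReal.toReal_mono ENNReal.one_ne_top (h1 a)).trans (by simpa using ht)
    simp [this]
  rw [h0, add_zero]
  refine setLIntegral_congr_fun measurableSet_Ioo fun t ht => ?_
  congr 1
  ext x
  exact (ENNReal.ofReal_lt_iff_lt_toReal ht.1.le (hfin x)).symm

/-- Since both suprema equal 1, the sets `{f > t}` and `{g > t}` are nonempty for every `t < 1`, and
their midpoints lie in `{h > t}`. One-dimensional Brunn–Minkowski at each level is then integrated
over `t`. Replacing `h` by `min h 1` confines the levels to `(0, 1)`. -/
theorem lintegral_add_lintegral_le_of_iSup_eq_one {f g h : ℝ → ℝ≥0∞} (hf : Measurable f)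
    (hg : Measurable g) (hh : Measurable h) (hf1 : ⨆ x, f x = 1) (hg1 : ⨆ x, g x = 1)
    (H : ∀ x y, f x * g y ≤ h ((1 / 2 : ℝ) * (x + y)) ^ 2) :
    (∫⁻ x, f x) + ∫⁻ x, g x ≤ 2 * ∫⁻ x, h x := by
  have hfl : ∀ x, f x ≤ 1 := fun x => hf1 ▸ le_iSup f x
  have hgl : ∀ x, g x ≤ 1 := fun x => hg1 ▸ le_iSup g x
  have hm : ∫⁻ x, min (h x) 1 ≤ ∫⁻ x, h x := lintegral_mono fun x => min_le_left _ _
  refine le_trans ?_ (mul_le_mul_right hm 2)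
  rw [lintegral_eq_lintegral_superlevel hf hfl, lintegral_eq_lintegral_superlevel hg hgl,
    lintegral_eq_lintegral_superlevel (hh.min measurable_const) fun x => min_le_right (h x) 1]
  have anti : ∀ u : ℝ → ℝ≥0∞, Measurable fun t : ℝ => volume {x | ENNReal.ofReal t < u x} := by
    intro u
    refine Antitone.measurable fun s t hst => measure_mono fun x hx => ?_
    exact (ENNReal.ofReal_le_ofReal hst).trans_lt hx
  rw [← lintegral_add_left (anti f), ← lintegral_const_mul _ (anti _)]
  refine setLIntegral_mono' measurableSet_Ioo fun t ht => ?_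
  have ht1 : ENNReal.ofReal t < 1 := by simpa using ht.2
  refine volume_add_volume_le (measurableSet_lt measurable_const hf)
    (measurableSet_lt measurable_const hg) ?_ ?_ ?_
  · exact lt_iSup_iff.mp (hf1 ▸ ht1)
  · exact lt_iSup_iff.mp (hg1 ▸ ht1)
  · intro x hx y hy
    simp only [Set.mem_ofPred_eq] at hx hy ⊢
    refine lt_min ?_ ht1
    have h2 : ENNReal.ofReal t ^ 2 < h ((1 / 2 : ℝ) * (x + y)) ^ 2 := by
      refine lt_of_lt_of_le ?_ (H x y)
      rw [sq]
      exact ENNReal.mul_lt_mul hx hy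
    exact lt_of_pow_lt_pow_left' 2 h2

/-- Dividing `f`, `g` by their suprema `a`, `b` and `h` by `√(ab)` preserves the hypothesis and
reduces to the additive inequality; the arithmetic–geometric mean inequality makes it
multiplicative. -/
theorem lintegral_mul_lintegral_le_of_bounded {f g h : ℝ → ℝ≥0∞} (hf : Measurable f)
    (hg : Measurable g) (hh : Measurable h) (hf1 : ⨆ x, f x ≠ ⊤) (hg1 : ⨆ x, g x ≠ ⊤)
    (H : ∀ x y, f x * g y ≤ h ((1 / 2 : ℝ) * (x + y)) ^ 2) :
    (∫⁻ x, f x) * ∫⁻ x, g x ≤ (∫⁻ x, h x) ^ 2 := by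
  rcases eq_or_ne (⨆ x, f x) 0 with hf0 | hf0
  · have : ∀ x, f x = 0 := by simpa using hf0
    simp [this]
  rcases eq_or_ne (⨆ x, g x) 0 with hg0 | hg0
  · have : ∀ x, g x = 0 := by simpa using hg0
    simp [this]
  generalize ha : (⨆ x, f x) = a at *
  generalize hb : (⨆ x, g x) = b at *
  set c : ℝ≥0∞ := (a * b) ^ (1 / 2 : ℝ) with hc
  have hc2 : c ^ 2 = a * b := by
    rw [hc, ← ENNReal.rpow_natCast, ← ENNReal.rpow_mul]; norm_num
  have hab0 : a * b ≠ 0 := mul_ne_zero hf0 hg0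
  have habt : a * b ≠ ⊤ := ENNReal.mul_ne_top hf1 hg1
  have hc0 : c ≠ 0 := fun h => hab0 (by rw [← hc2, h]; simp)
  have hct : c ≠ ⊤ := fun h => habt (by rw [← hc2, h]; simp)
  have key := lintegral_add_lintegral_le_of_iSup_eq_one (f := fun x => a⁻¹ * f x)
    (g := fun x => b⁻¹ * g x) (h := fun x => c⁻¹ * h x) (hf.const_mul _) (hg.const_mul _)
    (hh.const_mul _) (by rw [← ENNReal.mul_iSup, ha, ENNReal.inv_mul_cancel hf0 hf1])
    (by rw [← ENNReal.mul_iSup, hb, ENNReal.inv_mul_cancel hg0 hg1]) (by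
      intro x y
      rw [mul_pow, ← ENNReal.inv_pow, hc2, ENNReal.mul_inv (Or.inl hf0) (Or.inl hf1)]
      calc a⁻¹ * f x * (b⁻¹ * g y) = a⁻¹ * b⁻¹ * (f x * g y) := by ring
        _ ≤ _ := by gcongr; exact H x y)
  rw [lintegral_const_mul _ hf, lintegral_const_mul _ hg, lintegral_const_mul _ hh] at key
  generalize (∫⁻ x, f x) = F at *
  generalize (∫⁻ x, g x) = G at *
  generalize (∫⁻ x, h x) = I at *
  rcases eq_or_ne I ⊤ with rfl | hI
  · simp
  have hrt : 2 * (c⁻¹ * I) ≠ ⊤ :=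
    ENNReal.mul_ne_top (by simp) (ENNReal.mul_ne_top (by simpa using hc0) hI)
  have hF : a⁻¹ * F ≠ ⊤ := (lt_of_le_of_lt (le_self_add.trans key) hrt.lt_top).ne
  have hG : b⁻¹ * G ≠ ⊤ := (lt_of_le_of_lt (le_add_self.trans key) hrt.lt_top).ne
  have hFG : (a⁻¹ * F) * (b⁻¹ * G) ≤ (c⁻¹ * I) ^ 2 := by
    have hJ : c⁻¹ * I ≠ ⊤ := ENNReal.mul_ne_top (by simpa using hc0) hI
    generalize a⁻¹ * F = p at *
    generalize b⁻¹ * G = q at *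
    generalize c⁻¹ * I = r at *
    lift p to NNReal using hF
    lift q to NNReal using hG
    lift r to NNReal using hJ
    norm_cast at key ⊢
    rw [← NNReal.coe_le_coe] at key ⊢
    push_cast at key ⊢
    nlinarith [sq_nonneg ((p : ℝ) - q), p.coe_nonneg, q.coe_nonneg, r.coe_nonneg]
  calc F * G = (a * b) * ((a⁻¹ * F) * (b⁻¹ * G)) := by
        rw [show (a * b) * ((a⁻¹ * F) * (b⁻¹ * G)) = (a * a⁻¹) * (b * b⁻¹) * (F * G) by ring,
          ENNReal.mul_inv_cancel hf0 hf1, ENNReal.mul_inv_cancel hg0 hg1]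
        simp
    _ ≤ (a * b) * (c⁻¹ * I) ^ 2 := by gcongr
    _ = I ^ 2 := by
        rw [← hc2, ← mul_pow, ← mul_assoc, ENNReal.mul_inv_cancel hc0 hct, one_mul]

theorem lintegral_mul_lintegral_le_real {f g h : ℝ → ℝ≥0∞} (hf : Measurable f)
    (hg : Measurable g) (hh : Measurable h)
    (H : ∀ x y, f x * g y ≤ h ((1 / 2 : ℝ) * (x + y)) ^ 2) :
    (∫⁻ x, f x) * ∫⁻ x, g x ≤ (∫⁻ x, h x) ^ 2 := by
  have trunc : ∀ u : ℝ → ℝ≥0∞, Measurable u →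
      (∫⁻ x, u x) = ⨆ N : ℕ, ∫⁻ x, min (u x) N := by
    intro u hu
    rw [← lintegral_iSup (fun N => hu.min measurable_const)]
    · congr 1
      ext x
      rw [← inf_iSup_eq, ENNReal.iSup_natCast]
      simp
    · intro N M hNM x
      exact min_le_min_left _ (by exact_mod_cast hNM)
  have mono : ∀ u : ℝ → ℝ≥0∞, Monotone fun N : ℕ => ∫⁻ x, min (u x) N := fun u N M hNM =>
    lintegral_mono fun x => min_le_min_left _ (by exact_mod_cast hNM)
  have bdd : ∀ (u : ℝ → ℝ≥0∞) (N : ℕ), ⨆ x, min (u x) N ≠ ⊤ := fun u N =>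
    ((iSup_le fun x => min_le_right (u x) (N : ℝ≥0∞)).trans_lt (ENNReal.natCast_lt_top N)).ne
  rw [trunc f hf, trunc g hg, ENNReal.iSup_mul]
  refine iSup_le fun N => ?_
  rw [ENNReal.mul_iSup]
  refine iSup_le fun M => ?_
  refine (mul_le_mul' (mono f (le_max_left N M)) (mono g (le_max_right N M))).trans ?_
  generalize max N M = N
  refine lintegral_mul_lintegral_le_of_bounded (hf.min measurable_const) (hg.min measurable_const)
    hh (bdd f N) (bdd g N) fun x y => le_trans ?_ (H x y)
  exact mul_le_mul' (min_le_left _ _) (min_le_left _ _)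

/-- The Prékopa--Leindler inequality with equal weights. -/
theorem lintegral_mul_lintegral_le (n : ℕ) {f g h : (Fin n → ℝ) → ℝ≥0∞} (hf : Measurable f)
    (hg : Measurable g) (hh : Measurable h)
    (H : ∀ x y, f x * g y ≤ h ((1 / 2 : ℝ) • (x + y)) ^ 2) :
    (∫⁻ x, f x) * ∫⁻ x, g x ≤ (∫⁻ x, h x) ^ 2 := by
  induction n with
  | zero =>
    have : ∀ u : (Fin 0 → ℝ) → ℝ≥0∞, ∫⁻ x, u x = u 0 := by
      intro u
      rw [lintegral_unique]
      simp only [volume_pi, Measure.pi_univ, Finset.univ_eq_empty, Finset.prod_empty, mul_one]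
      exact congrArg u (Subsingleton.elim _ _)
    rw [this, this, this]
    simpa using H 0 0
  | succ n ih =>
    let e := (MeasurableEquiv.piFinSuccAbove (fun _ : Fin (n + 1) => ℝ) 0).symm
    have he : MeasurePreserving e :=
      (volume_preserving_piFinSuccAbove (fun _ : Fin (n + 1) => ℝ) 0).symm
    have fub : ∀ u : (Fin (n + 1) → ℝ) → ℝ≥0∞, Measurable u →
        ∫⁻ x, u x = ∫⁻ s : ℝ, ∫⁻ v : Fin n → ℝ, u (e (s, v)) := by
      intro u hu
      rw [← he.lintegral_comp hu, Measure.volume_eq_prod]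
      exact lintegral_prod _ (hu.comp e.measurable).aemeasurable
    rw [fub f hf, fub g hg, fub h hh]
    -- Induction on dimension: by the inductive hypothesis on the slices, the integrals over slices
    -- satisfy the one-dimensional hypothesis.
    refine lintegral_mul_lintegral_le_real (hf.comp e.measurable).lintegral_prod_right'
      (hg.comp e.measurable).lintegral_prod_right' (hh.comp e.measurable).lintegral_prod_right' ?_
    intro s t
    refine ih (hf.comp (e.measurable.comp measurable_prodMk_left))
      (hg.comp (e.measurable.comp measurable_prodMk_left))
      (hh.comp (e.measurable.comp measurable_prodMk_left)) fun x y => ?_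
    have hmid : e ((1 / 2 : ℝ) * (s + t), (1 / 2 : ℝ) • (x + y))
        = (1 / 2 : ℝ) • (e (s, x) + e (t, y)) := by
      ext i
      refine Fin.cases ?_ (fun j => ?_) i <;>
        simp [e, MeasurableEquiv.piFinSuccAbove, Fin.insertNthEquiv, mul_add]
    simpa only [Function.comp_apply, hmid] using H (e (s, x)) (e (t, y))

/-- The multiplicative Brunn--Minkowski inequality, for the midpoint set. -/
theorem volume_mul_volume_le {m : ℕ} {A B C : Set (Euc m)} (hA : MeasurableSet A)
    (hB : MeasurableSet B) (hC : MeasurableSet C)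
    (H : ∀ x ∈ A, ∀ y ∈ B, (1 / 2 : ℝ) • (x + y) ∈ C) :
    volume A * volume B ≤ volume C ^ 2 := by
  have hT : MeasurePreserving (WithLp.toLp 2 : (Fin (m + 1) → ℝ) → Euc m) :=
    PiLp.volume_preserving_toLp (Fin (m + 1))
  have hv : ∀ S : Set (Euc m), MeasurableSet S → volume S =
      ∫⁻ x : Fin (m + 1) → ℝ, (WithLp.toLp 2 ⁻¹' S).indicator 1 x := by
    intro S hS
    rw [lintegral_indicator_one (hT.measurable hS), hT.measure_preimage hS.nullMeasurableSet]
  rw [hv A hA, hv B hB, hv C hC]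
  refine lintegral_mul_lintegral_le (m + 1) ?_ ?_ ?_ fun x y => ?_
  · exact measurable_one.indicator (hT.measurable hA)
  · exact measurable_one.indicator (hT.measurable hB)
  · exact measurable_one.indicator (hT.measurable hC)
  by_cases hx : WithLp.toLp 2 x ∈ A
  · by_cases hy : WithLp.toLp 2 y ∈ B
    · have := H _ hx _ hy
      have h3 : (1 / 2 : ℝ) • (x + y) ∈ (WithLp.toLp 2 ⁻¹' C : Set (Fin (m + 1) → ℝ)) := by
        simpa only [Set.mem_preimage, WithLp.toLp_smul, WithLp.toLp_add] using this
      rw [Set.indicator_of_mem h3]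
      have hle : ∀ (S : Set (Fin (m + 1) → ℝ)) (z), S.indicator (1 : (Fin (m + 1) → ℝ) → ℝ≥0∞) z ≤ 1 :=
        fun S z => Set.indicator_apply_le' (fun _ => le_rfl) fun _ => zero_le
      simpa using mul_le_mul' (hle _ x) (hle _ y)
    · simp [hy]
  · simp [hx]

end CentroAffine

/-! ### Calculus of 1-homogeneous functions and determinants in an adapted frame -/

namespace CentroAffine

/-- `C²` functions on `ℝⁿ ∖ {0}` that are positively `1`-homogeneous. -/
structure HomC2 {m : ℕ} (F : Euc m → ℝ) : Prop where
  contDiffAt : ∀ y, y ≠ 0 → ContDiffAt ℝ 2 F y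
  homog : ∀ c : ℝ, 0 < c → ∀ y, F (c • y) = c * F y

namespace HomC2

variable {m : ℕ} {F G : Euc m → ℝ}

theorem map_zero (hF : HomC2 F) : F 0 = 0 := by
  have := hF.homog 2 two_pos 0
  rw [smul_zero] at this
  linarith

theorem add (hF : HomC2 F) (hG : HomC2 G) : HomC2 fun y => F y + G y where
  contDiffAt y hy := (hF.contDiffAt y hy).add (hG.contDiffAt y hy)
  homog c hc y := by rw [hF.homog c hc, hG.homog c hc]; ring

theorem const_mul (hF : HomC2 F) (t : ℝ) : HomC2 fun y => t * F y where
  contDiffAt y hy := contDiffAt_const.mul (hF.contDiffAt y hy)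
  homog c hc y := by rw [hF.homog c hc]; ring

theorem differentiableAt (hF : HomC2 F) {y : Euc m} (hy : y ≠ 0) : DifferentiableAt ℝ F y :=
  (hF.contDiffAt y hy).differentiableAt (by norm_num)

theorem contDiffAt_fderiv (hF : HomC2 F) {y : Euc m} (hy : y ≠ 0) :
    ContDiffAt ℝ 1 (fderiv ℝ F) y :=
  (hF.contDiffAt y hy).fderiv_right (by norm_num)

theorem differentiableAt_fderiv (hF : HomC2 F) {y : Euc m} (hy : y ≠ 0) :
    DifferentiableAt ℝ (fderiv ℝ F) y :=
  (hF.contDiffAt_fderiv hy).differentiableAt (by norm_num)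

theorem continuousAt_hess (hF : HomC2 F) {y : Euc m} (hy : y ≠ 0) :
    ContinuousAt (fderiv ℝ (fderiv ℝ F)) y :=
  ((hF.contDiffAt_fderiv hy).fderiv_right (m := 0) (by norm_num)).continuousAt

theorem continuousOn (hF : HomC2 F) : ContinuousOn F {0}ᶜ := fun _ hy =>
  (hF.differentiableAt hy).continuousAt.continuousWithinAt

theorem hess_add (hF : HomC2 F) (hG : HomC2 G) {y : Euc m} (hy : y ≠ 0) :
    fderiv ℝ (fderiv ℝ fun y => F y + G y) y
      = fderiv ℝ (fderiv ℝ F) y + fderiv ℝ (fderiv ℝ G) y := by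
  have h : (fderiv ℝ fun y => F y + G y) =ᶠ[𝓝 y] fun x => fderiv ℝ F x + fderiv ℝ G x := by
    filter_upwards [isOpen_ne.mem_nhds hy] with x hx
    exact fderiv_fun_add (hF.differentiableAt hx) (hG.differentiableAt hx)
  rw [h.fderiv_eq]
  exact fderiv_fun_add (hF.differentiableAt_fderiv hy) (hG.differentiableAt_fderiv hy)

theorem hess_const_mul (hF : HomC2 F) (t : ℝ) {y : Euc m} (hy : y ≠ 0) :
    fderiv ℝ (fderiv ℝ fun y => t * F y) y = t • fderiv ℝ (fderiv ℝ F) y := by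
  have h : (fderiv ℝ fun y => t * F y) =ᶠ[𝓝 y] fun x => t • fderiv ℝ F x := by
    filter_upwards [isOpen_ne.mem_nhds hy] with x hx
    exact fderiv_const_mul (hF.differentiableAt hx) t
  rw [h.fderiv_eq]
  exact fderiv_fun_const_smul (hF.differentiableAt_fderiv hy) t

theorem fderiv_smul (hF : HomC2 F) {c : ℝ} (hc : 0 < c) (y : Euc m) :
    fderiv ℝ F (c • y) = fderiv ℝ F y := by
  rcases eq_or_ne y 0 with rfl | hy
  · rw [smul_zero]
  have h1 : (fun x => F (c • x)) = fun x => c * F x := funext fun x => hF.homog c hc x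
  have h2 := fderiv_comp_smul (𝕜 := ℝ) (f := F) (x := y) c
  rw [h1, fderiv_const_mul (hF.differentiableAt hy)] at h2
  exact (smul_right_injective _ hc.ne' h2).symm

theorem hess_smul (hF : HomC2 F) {c : ℝ} (hc : 0 < c) (y : Euc m) :
    c • fderiv ℝ (fderiv ℝ F) (c • y) = fderiv ℝ (fderiv ℝ F) y := by
  have h1 : (fun x => fderiv ℝ F (c • x)) = fderiv ℝ F := funext fun x => hF.fderiv_smul hc x
  have h2 := fderiv_comp_smul (𝕜 := ℝ) (f := fderiv ℝ F) (x := y) c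
  rw [h1] at h2
  exact h2.symm

theorem hasDerivAt_ray (y : Euc m) : HasDerivAt (fun c : ℝ => c • y) y 1 := by
  simpa using (hasDerivAt_id (1 : ℝ)).smul_const y

/-- Euler's identity. -/
theorem fderiv_self (hF : HomC2 F) {y : Euc m} (hy : y ≠ 0) : fderiv ℝ F y y = F y := by
  have h1 : HasDerivAt (fun c : ℝ => F (c • y)) (fderiv ℝ F y y) 1 := by
    have := (hF.differentiableAt hy).hasFDerivAt
    rw [← one_smul ℝ y] at this
    simpa [Function.comp_def] using this.comp_hasDerivAt 1 (hasDerivAt_ray y)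
  have h2 : HasDerivAt (fun c : ℝ => F (c • y)) (F y) 1 := by
    have h3 : HasDerivAt (fun c : ℝ => c * F y) (F y) 1 := by
      simpa using (hasDerivAt_id (1 : ℝ)).mul_const (F y)
    refine h3.congr_of_eventuallyEq ?_
    filter_upwards [lt_mem_nhds (zero_lt_one (α := ℝ))] with c hc
    exact hF.homog c hc y
  exact h1.unique h2

/-- The first derivative is constant along rays. Consequently the Hessian is determined by its
restriction to the tangent space of the sphere. -/
theorem hess_self (hF : HomC2 F) {y : Euc m} (hy : y ≠ 0) : fderiv ℝ (fderiv ℝ F) y y = 0 := by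
  have h1 : HasDerivAt (fun c : ℝ => fderiv ℝ F (c • y)) (fderiv ℝ (fderiv ℝ F) y y) 1 := by
    have := (hF.differentiableAt_fderiv hy).hasFDerivAt
    rw [← one_smul ℝ y] at this
    simpa [Function.comp_def] using this.comp_hasDerivAt 1 (hasDerivAt_ray y)
  have h2 : HasDerivAt (fun c : ℝ => fderiv ℝ F (c • y)) 0 1 := by
    refine (hasDerivAt_const (1 : ℝ) (fderiv ℝ F y)).congr_of_eventuallyEq ?_
    filter_upwards [lt_mem_nhds (zero_lt_one (α := ℝ))] with c hc
    exact hF.fderiv_smul hc y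
  exact h1.unique h2

theorem hess_symm (hF : HomC2 F) {y : Euc m} (hy : y ≠ 0) (v w : Euc m) :
    fderiv ℝ (fderiv ℝ F) y v w = fderiv ℝ (fderiv ℝ F) y w v :=
  ((hF.contDiffAt y hy).isSymmSndFDerivAt (by simp)).eq v w

theorem hess_apply_self (hF : HomC2 F) {y : Euc m} (hy : y ≠ 0) (v : Euc m) :
    fderiv ℝ (fderiv ℝ F) y v y = 0 := by
  rw [hF.hess_symm hy, hF.hess_self hy]; rfl

end HomC2

section gradient

variable {m : ℕ} {F : Euc m → ℝ}

theorem inner_gradient (F : Euc m → ℝ) (y v : Euc m) :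
    inner ℝ (gradient F y) v = fderiv ℝ F y v := by
  simp [gradient]

theorem gradient_eq_sum (F : Euc m → ℝ) (y : Euc m) :
    gradient F y = ∑ i, fderiv ℝ F y (EuclideanSpace.basisFun (Fin (m + 1)) ℝ i) •
      EuclideanSpace.basisFun (Fin (m + 1)) ℝ i := by
  conv_lhs => rw [← (EuclideanSpace.basisFun (Fin (m + 1)) ℝ).sum_repr' (gradient F y)]
  refine Finset.sum_congr rfl fun i _ => ?_
  rw [real_inner_comm, inner_gradient]

theorem _root_.ContDiffAt.contDiffAt_gradient {y : Euc m} (hF : ContDiffAt ℝ 2 F y) :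
    ContDiffAt ℝ 1 (gradient F) y := by
  have : gradient F = fun y => ∑ i, fderiv ℝ F y (EuclideanSpace.basisFun (Fin (m + 1)) ℝ i) •
      EuclideanSpace.basisFun (Fin (m + 1)) ℝ i := funext (gradient_eq_sum F)
  rw [this]
  refine ContDiffAt.sum fun i _ => ?_
  exact ((hF.fderiv_right (m := 1) (by norm_num)).clm_apply contDiffAt_const).smul contDiffAt_const

theorem inner_fderiv_gradient {y : Euc m} (hF : ContDiffAt ℝ 2 F y) (w v : Euc m) :
    inner ℝ (fderiv ℝ (gradient F) y w) v = fderiv ℝ (fderiv ℝ F) y w v := by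
  have h1 : DifferentiableAt ℝ (fderiv ℝ F) y :=
    (hF.fderiv_right (m := 1) (by norm_num)).differentiableAt (by norm_num)
  have h2 : fderiv ℝ (fun x => inner ℝ (gradient F x) v) y w
      = inner ℝ (fderiv ℝ (gradient F) y w) v := by
    rw [fderiv_inner_apply ℝ (hF.contDiffAt_gradient.differentiableAt (by norm_num))
      (differentiableAt_const v)]
    simp
  rw [← h2]
  simp only [inner_gradient]
  rw [fderiv_clm_apply h1 (differentiableAt_const v)]
  simp

theorem HomC2.differentiableAt_gradient (hF : HomC2 F) {y : Euc m} (hy : y ≠ 0) :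
    DifferentiableAt ℝ (gradient F) y :=
  (hF.contDiffAt y hy).contDiffAt_gradient.differentiableAt (by norm_num)

theorem HomC2.inner_fderiv_gradient (hF : HomC2 F) {y : Euc m} (hy : y ≠ 0) (w v : Euc m) :
    inner ℝ (fderiv ℝ (gradient F) y w) v = fderiv ℝ (fderiv ℝ F) y w v :=
  CentroAffine.inner_fderiv_gradient (hF.contDiffAt y hy) w v

end gradient

section frame

variable {m : ℕ}

theorem norm_coe_sph (θ : Sph m) : ‖(θ : Euc m)‖ = 1 := by simp

theorem coe_sph_ne_zero (θ : Sph m) : (θ : Euc m) ≠ 0 := ne_zero_of_mem_unit_sphere θ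

theorem inner_frame_frame (θ : Sph m) (i j : Fin m) :
    inner ℝ (frame θ i) (frame θ j) = if i = j then 1 else 0 := by
  have := Fact.mk (finrank_euclideanSpace_fin (𝕜 := ℝ) (n := m + 1))
  exact orthonormal_iff_ite.mp (OrthonormalBasis.fromOrthogonalSpanSingleton (𝕜 := ℝ) m
    (ne_zero_of_mem_unit_sphere θ)).orthonormal i j

theorem inner_self_frame (θ : Sph m) (i : Fin m) : inner ℝ (θ : Euc m) (frame θ i) = 0 := by
  have := Fact.mk (finrank_euclideanSpace_fin (𝕜 := ℝ) (n := m + 1))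
  exact Submodule.mem_orthogonal_singleton_iff_inner_right.mp
    (OrthonormalBasis.fromOrthogonalSpanSingleton (𝕜 := ℝ) m (ne_zero_of_mem_unit_sphere θ) i).2

theorem orthonormal_snoc_frame (θ : Sph m) :
    Orthonormal ℝ (Fin.snoc (α := fun _ => Euc m) (frame θ) (θ : Euc m)) := by
  rw [orthonormal_iff_ite]
  intro i j
  refine Fin.lastCases ?_ (fun i => ?_) i <;> refine Fin.lastCases ?_ (fun j => ?_) j
  · simp
  · simp [inner_self_frame, (Fin.castSucc_lt_last j).ne']
  · simp [real_inner_comm, inner_self_frame, (Fin.castSucc_lt_last i).ne]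
  · simp [inner_frame_frame]

/-- The orthonormal basis `e₁, …, e_{n-1}, θ` of `ℝⁿ`. -/
noncomputable def frameBasis (θ : Sph m) : OrthonormalBasis (Fin (m + 1)) ℝ (Euc m) :=
  OrthonormalBasis.mk (orthonormal_snoc_frame θ) (by
    rw [(orthonormal_snoc_frame θ).linearIndependent.span_eq_top_of_card_eq_finrank' (by simp)])

theorem coe_frameBasis (θ : Sph m) :
    ⇑(frameBasis θ) = Fin.snoc (α := fun _ => Euc m) (frame θ) (θ : Euc m) := by
  simp [frameBasis]

@[simp] theorem frameBasis_castSucc (θ : Sph m) (i : Fin m) :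
    frameBasis θ i.castSucc = frame θ i := by
  simp [coe_frameBasis]

@[simp] theorem frameBasis_last (θ : Sph m) : frameBasis θ (Fin.last m) = θ := by
  simp [coe_frameBasis]

theorem det_eq_of_last_row {M : Matrix (Fin (m + 1)) (Fin (m + 1)) ℝ}
    (h : ∀ j : Fin m, M (Fin.last m) j.castSucc = 0) :
    M.det = M (Fin.last m) (Fin.last m) * (M.submatrix Fin.castSucc Fin.castSucc).det := by
  rw [Matrix.det_succ_row M (Fin.last m), Fin.sum_univ_castSucc]
  simp [h, ← two_mul, pow_mul]

/-- In the orthonormal basis `e₁, …, e_m, θ` the form `D²F + θ ⊗ θ` is block diagonal, with blocks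
`D²F` on the tangent space and 1. The point is continuity: `frame θ` is an arbitrary choice that
need not depend continuously on `θ`, while the left side is written in the standard basis. -/
theorem det_hess_add (θ : Sph m) {F : Euc m → ℝ} (hF : HomC2 F) :
    (Matrix.of fun i j : Fin (m + 1) =>
      fderiv ℝ (fderiv ℝ F) (θ : Euc m) (EuclideanSpace.basisFun (Fin (m + 1)) ℝ i)
        (EuclideanSpace.basisFun (Fin (m + 1)) ℝ j) + (θ : Euc m) i * (θ : Euc m) j).det
      = (hessMatrix F θ).det := by
  set e := EuclideanSpace.basisFun (Fin (m + 1)) ℝ with he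
  set β : Euc m → Euc m → ℝ := fun v w =>
    fderiv ℝ (fderiv ℝ F) (θ : Euc m) v w + inner ℝ (θ : Euc m) v * inner ℝ (θ : Euc m) w with hβ
  set M : Matrix (Fin (m + 1)) (Fin (m + 1)) ℝ := Matrix.of fun i j => β (e i) (e j) with hM
  set N : Matrix (Fin (m + 1)) (Fin (m + 1)) ℝ :=
    Matrix.of fun i j => β (frameBasis θ i) (frameBasis θ j) with hN
  set B : Matrix (Fin (m + 1)) (Fin (m + 1)) ℝ :=
    Matrix.of fun a i => inner ℝ (e i) (frameBasis θ a) with hB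
  have hBB : B * B.transpose = 1 := by
    ext a b
    simp only [Matrix.mul_apply, hB, Matrix.transpose_apply, Matrix.of_apply]
    have := e.sum_inner_mul_inner (frameBasis θ a) (frameBasis θ b)
    simp only [real_inner_comm _ (frameBasis θ a)] at this ⊢
    rw [this, orthonormal_iff_ite.mp (frameBasis θ).orthonormal, Matrix.one_apply]
    simp only [eq_comm]
  have hBNB : B * M * B.transpose = N := by
    ext a b
    have ha := e.sum_repr' (frameBasis θ a)
    have hb := e.sum_repr' (frameBasis θ b)
    simp only [hN, Matrix.of_apply, Matrix.mul_apply, Matrix.transpose_apply]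
    conv_rhs => rw [← ha, ← hb]
    simp only [hβ, hM, hB, Matrix.of_apply, map_sum, map_smul, inner_sum, inner_smul_right,
      sum_apply, smul_apply, smul_eq_mul,
      Finset.sum_mul, Finset.mul_sum, mul_add, add_mul, Finset.sum_add_distrib]
    congr 1
    · refine Finset.sum_congr rfl fun i _ => Finset.sum_congr rfl fun j _ => by ring
    · refine Finset.sum_congr rfl fun i _ => Finset.sum_congr rfl fun j _ => by ring
  have h1 : M.det = N.det := by
    rw [← hBNB, Matrix.det_conj_of_mul_eq_one hBB (mul_eq_one_comm.mp hBB)]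
  have h2 : N.det = (hessMatrix F θ).det := by
    rw [det_eq_of_last_row]
    · have : N.submatrix Fin.castSucc Fin.castSucc = hessMatrix F θ := by
        ext i j
        simp [hN, hβ, hessMatrix, inner_self_frame]
      rw [this]
      simp [hN, hβ, hF.hess_self (coe_sph_ne_zero θ)]
    · intro j
      simp [hN, hβ, hF.hess_self (coe_sph_ne_zero θ), inner_self_frame]
  rw [← h2, ← h1]
  congr 1
  ext i j
  simp [hM, hβ, he, PiLp.inner_apply]

/-- The map `y ↦ |y| ∇F(y)`, which takes `r θ` to `r ∇F(θ)`. -/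
noncomputable def polarMap (F : Euc m → ℝ) (y : Euc m) : Euc m := ‖y‖ • gradient F y

theorem HomC2.differentiableAt_polarMap {F : Euc m → ℝ} (hF : HomC2 F) {y : Euc m} (hy : y ≠ 0) :
    DifferentiableAt ℝ (polarMap F) y :=
  ((contDiffAt_norm ℝ hy (n := 1)).differentiableAt (by norm_num)).smul
    (hF.differentiableAt_gradient hy)

theorem fderiv_norm_coe_sph (θ : Sph m) (w : Euc m) :
    fderiv ℝ (fun y : Euc m => ‖y‖) (θ : Euc m) w = inner ℝ (θ : Euc m) w := by
  have h0 : DifferentiableAt ℝ (fun y : Euc m => ‖y‖) (θ : Euc m) :=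
    (contDiffAt_norm ℝ (coe_sph_ne_zero θ) (n := 1)).differentiableAt (by norm_num)
  have h1 : fderiv ℝ (fun y : Euc m => ‖y‖ ^ 2) (θ : Euc m) w = 2 * inner ℝ (θ : Euc m) w := by
    rw [fderiv_norm_sq_apply]; simp
  have h2 : fderiv ℝ (fun y : Euc m => ‖y‖ ^ 2) (θ : Euc m) w
      = 2 * fderiv ℝ (fun y : Euc m => ‖y‖) (θ : Euc m) w := by
    rw [fderiv_fun_pow _ h0]
    simp
  linarith

theorem HomC2.fderiv_polarMap {F : Euc m → ℝ} (hF : HomC2 F) (θ : Sph m) (w : Euc m) :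
    fderiv ℝ (polarMap F) (θ : Euc m) w
      = inner ℝ (θ : Euc m) w • gradient F θ + fderiv ℝ (gradient F) θ w := by
  have h0 : DifferentiableAt ℝ (fun y : Euc m => ‖y‖) (θ : Euc m) :=
    (contDiffAt_norm ℝ (coe_sph_ne_zero θ) (n := 1)).differentiableAt (by norm_num)
  unfold polarMap
  rw [fderiv_fun_smul h0 (hF.differentiableAt_gradient (coe_sph_ne_zero θ))]
  simp [fderiv_norm_coe_sph]
  abel

theorem HomC2.fderiv_gradient_self {F : Euc m → ℝ} (hF : HomC2 F) (θ : Sph m) :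
    fderiv ℝ (gradient F) (θ : Euc m) θ = 0 := by
  refine ext_inner_right ℝ fun v => ?_
  rw [hF.inner_fderiv_gradient (coe_sph_ne_zero θ), hF.hess_self (coe_sph_ne_zero θ)]
  simp

theorem HomC2.fderiv_polarMap_comp_frameBasis {F : Euc m → ℝ} (hF : HomC2 F) (θ : Sph m) :
    (fderiv ℝ (polarMap F) (θ : Euc m)).toLinearMap ∘ frameBasis θ
      = Fin.snoc (α := fun _ => Euc m)
        (fun i => fderiv ℝ (gradient F) (θ : Euc m) (frame θ i)) (gradient F (θ : Euc m)) := by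
  ext1 i
  refine Fin.lastCases ?_ (fun i => ?_) i
  · simp [hF.fderiv_polarMap, hF.fderiv_gradient_self]
  · simp [hF.fderiv_polarMap, inner_self_frame]

/-- The derivative sends `e_i` to `D²F e_i`, which is orthogonal to `θ`, and sends `θ` to `∇F(θ)`,
whose `θ`-component is `F(θ)` by Euler's identity. The matrix is therefore block triangular. -/
theorem HomC2.det_fderiv_polarMap {F : Euc m → ℝ} (hF : HomC2 F) (θ : Sph m) :
    (fderiv ℝ (polarMap F) (θ : Euc m)).det = F θ * (hessMatrix F θ).det := by
  set o := frameBasis θ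
  have h1 := o.toBasis.det_comp (fderiv ℝ (polarMap F) (θ : Euc m)).toLinearMap o
  have h2 : o.toBasis.det o = 1 := by
    have := o.toBasis.det_self
    rwa [o.coe_toBasis] at this
  rw [h2, mul_one, hF.fderiv_polarMap_comp_frameBasis, Module.Basis.det_apply,
    det_eq_of_last_row] at h1
  · rw [ContinuousLinearMap.det, ← h1]
    congr 1
    · simp [Module.Basis.toMatrix_apply, o.coe_toBasis_repr_apply, o.repr_apply_apply, o]
      exact hF.fderiv_self (coe_sph_ne_zero θ)
    · rw [← Matrix.det_transpose]
      congr 1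
      ext i j
      simp [Module.Basis.toMatrix_apply, o.coe_toBasis_repr_apply, o.repr_apply_apply, o,
        hessMatrix]
      rw [real_inner_comm, hF.inner_fderiv_gradient (coe_sph_ne_zero θ)]
  · intro j
    simp [Module.Basis.toMatrix_apply, o.coe_toBasis_repr_apply, o.repr_apply_apply, o]
    rw [real_inner_comm, hF.inner_fderiv_gradient (coe_sph_ne_zero θ),
      hF.hess_apply_self (coe_sph_ne_zero θ)]

/-- This turns the centro-affine density into `|h det D²h|`: the listed vectors are the images of an
orthonormal basis under the derivative of `polarMap`, and a change of orthonormal basis costs only a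
sign. -/
theorem HomC2.abs_det_snoc {F : Euc m → ℝ} (hF : HomC2 F) (θ : Sph m) :
    |(EuclideanSpace.basisFun (Fin (m + 1)) ℝ).toBasis.det
      (Fin.snoc (α := fun _ => Euc m)
        (fun i => fderiv ℝ (gradient F) (θ : Euc m) (frame θ i)) (gradient F (θ : Euc m)))|
      = |F θ * (hessMatrix F θ).det| := by
  rw [← hF.fderiv_polarMap_comp_frameBasis, Module.Basis.det_comp, abs_mul]
  have h : |(EuclideanSpace.basisFun (Fin (m + 1)) ℝ).toBasis.det (frameBasis θ)| = 1 := by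
    rcases (EuclideanSpace.basisFun (Fin (m + 1)) ℝ).det_to_matrix_orthonormalBasis_real
      (frameBasis θ) with h | h <;> simp [h]
  rw [h, mul_one, ← hF.det_fderiv_polarMap]

end frame

end CentroAffine

/-! ### Admissible support functions and volumes of Wulff shapes -/

namespace CentroAffine

namespace HomC2

variable {m : ℕ}

theorem gradient_smul {F : Euc m → ℝ} (hF : HomC2 F) {c : ℝ} (hc : 0 < c)
    (y : Euc m) : gradient F (c • y) = gradient F y := by
  simp only [gradient, hF.fderiv_smul hc]

theorem polarMap_smul {F : Euc m → ℝ} (hF : HomC2 F) {c : ℝ} (hc : 0 < c)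
    (y : Euc m) : polarMap F (c • y) = c • polarMap F y := by
  simp only [polarMap, hF.gradient_smul hc, norm_smul, Real.norm_of_nonneg hc.le, smul_smul]

theorem fderiv_polarMap_smul {F : Euc m → ℝ} (hF : HomC2 F) {c : ℝ} (hc : 0 < c)
    {y : Euc m} (hy : y ≠ 0) : fderiv ℝ (polarMap F) (c • y) = fderiv ℝ (polarMap F) y := by
  have h1 : (fun x => polarMap F (c • x)) = fun x => c • polarMap F x :=
    funext fun x => hF.polarMap_smul hc x
  have h2 := fderiv_comp_smul (𝕜 := ℝ) (f := polarMap F) (x := y) c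
  rw [h1, fderiv_fun_const_smul (hF.differentiableAt_polarMap hy)] at h2
  exact (smul_right_injective _ hc.ne' h2).symm

end HomC2

/-- Support functions of convex bodies with `C²` boundary of positive curvature and with the origin
in the interior. -/
structure IsAdmissible {m : ℕ} (h : Euc m → ℝ) : Prop extends HomC2 h where
  pos : ∀ y, y ≠ 0 → 0 < h y
  hess_pos : ∀ θ w : Euc m, ‖θ‖ = 1 → inner ℝ θ w = 0 → w ≠ 0 →
    0 < fderiv ℝ (fderiv ℝ h) θ w w

variable {m : ℕ} {h k : Euc m → ℝ}

theorem exists_eq_smul_coe_sph {y : Euc m} (hy : y ≠ 0) :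
    ∃ (r : ℝ) (θ : Sph m), 0 < r ∧ y = r • (θ : Euc m) := by
  refine ⟨‖y‖, ⟨‖y‖⁻¹ • y, ?_⟩, norm_pos_iff.mpr hy, ?_⟩
  · rw [mem_sphere_zero_iff_norm, norm_smul, norm_inv, norm_norm,
      inv_mul_cancel₀ (norm_ne_zero_iff.mpr hy)]
  · rw [smul_smul, mul_inv_cancel₀ (norm_ne_zero_iff.mpr hy), one_smul]

theorem exists_eq_smul_add_orthogonal (θ : Sph m) (v : Euc m) :
    ∃ (c : ℝ) (w : Euc m), inner ℝ (θ : Euc m) w = 0 ∧ v = c • (θ : Euc m) + w := by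
  refine ⟨inner ℝ (θ : Euc m) v, v - inner ℝ (θ : Euc m) v • (θ : Euc m), ?_, by abel⟩
  rw [inner_sub_right, inner_smul_right, real_inner_self_eq_norm_sq, norm_coe_sph]
  ring

theorem HomC2.hess_smul_add {F : Euc m → ℝ} (hF : HomC2 F) {y : Euc m} (hy : y ≠ 0) (c : ℝ)
    (w : Euc m) : fderiv ℝ (fderiv ℝ F) y (c • y + w) (c • y + w) = fderiv ℝ (fderiv ℝ F) y w w := by
  simp [hF.hess_self hy, hF.hess_apply_self hy]

namespace IsAdmissible

theorem hess_pos_of_not_parallel (hh : IsAdmissible h) {y v : Euc m} (hy : y ≠ 0)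
    (hv : ∀ c : ℝ, v ≠ c • y) : 0 < fderiv ℝ (fderiv ℝ h) y v v := by
  obtain ⟨r, θ, hr, rfl⟩ := exists_eq_smul_coe_sph hy
  obtain ⟨c, w, hw, rfl⟩ := exists_eq_smul_add_orthogonal θ v
  have hw0 : w ≠ 0 := by
    rintro rfl
    refine hv (c / r) ?_
    rw [smul_smul, div_mul_cancel₀ _ hr.ne', add_zero]
  have h1 := hh.hess_pos θ w (norm_coe_sph θ) hw hw0
  rw [← hh.hess_smul_add (coe_sph_ne_zero θ) c, ← hh.hess_smul hr] at h1
  rw [smul_apply, smul_apply, smul_eq_mul] at h1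
  exact pos_of_mul_pos_right h1 hr.le

/-- Strict convexity: the graph lies above its tangent hyperplane, away from the ray of contact. -/
theorem fderiv_apply_lt (hh : IsAdmissible h) {y z : Euc m} (hy : y ≠ 0)
    (hz : ∀ c : ℝ, 0 ≤ c → z ≠ c • y) : fderiv ℝ h y z < h z := by
  have hz0 : z ≠ 0 := by simpa using hz 0 le_rfl
  by_cases hpar : ∃ c : ℝ, z = c • y
  · obtain ⟨c, hc⟩ := hpar
    have hc0 : c < 0 := by
      by_contra hc0
      exact hz c (not_lt.mp hc0) hc
    have h1 := hh.pos z hz0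
    have h2 : fderiv ℝ h y z = c * h y := by
      rw [hc, map_smul, hh.fderiv_self hy, smul_eq_mul]
    nlinarith [hh.pos y hy]
  push Not at hpar
  set v := z - y with hv
  -- Since `z` is not a multiple of `y`, the line through them misses the origin and its direction
  -- is never parallel to the position vector. So `h` is strictly convex along it, and the mean
  -- value theorem on `[0, 1]` gives the strict inequality.
  have hseg : ∀ s : ℝ, y + s • v ≠ 0 := by
    intro s hs
    have h1 : s • z = (s - 1) • y := by
      have h2 : y + s • v = s • z - (s - 1) • y := by rw [hv]; module
      rw [h2] at hs
      exact sub_eq_zero.mp hs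
    rcases eq_or_ne s 0 with rfl | hs0
    · simp [hy] at hs
    · refine hpar (s⁻¹ * (s - 1)) ?_
      rw [mul_smul, ← h1, smul_smul, inv_mul_cancel₀ hs0, one_smul]
  have hpos : ∀ s : ℝ, 0 < fderiv ℝ (fderiv ℝ h) (y + s • v) v v := by
    intro s
    refine hh.hess_pos_of_not_parallel (hseg s) fun c hc => ?_
    have h1 : (1 - c * s) • z = (1 + c * (1 - s)) • y := by
      have h2 : (1 - c * s) • z - (1 + c * (1 - s)) • y = v - c • (y + s • v) := by
        rw [hv]; module
      rw [← sub_eq_zero, h2, ← hc, sub_self]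
    rcases eq_or_ne (1 - c * s) 0 with h0 | h0
    · rw [h0, zero_smul, eq_comm, smul_eq_zero] at h1
      rcases h1 with h1 | h1
      · have hc1 : c = 0 := by linarith
        simp [hc1] at h0
      · exact hy h1
    · refine hpar ((1 - c * s)⁻¹ * (1 + c * (1 - s))) ?_
      rw [mul_smul, ← h1, smul_smul, inv_mul_cancel₀ h0, one_smul]
  have hline : ∀ s : ℝ, HasDerivAt (fun s : ℝ => y + s • v) v s := fun s => by
    simpa using ((hasDerivAt_id s).smul_const v).const_add y
  have hd1 : ∀ s : ℝ, HasDerivAt (fun s : ℝ => h (y + s • v)) (fderiv ℝ h (y + s • v) v) s :=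
    fun s => (hh.differentiableAt (hseg s)).hasFDerivAt.comp_hasDerivAt s (hline s)
  have hd2 : ∀ s : ℝ, HasDerivAt (fun s : ℝ => fderiv ℝ h (y + s • v) v)
      (fderiv ℝ (fderiv ℝ h) (y + s • v) v v) s := fun s =>
    (ContinuousLinearMap.apply ℝ ℝ v).hasFDerivAt.comp_hasDerivAt s
      ((hh.differentiableAt_fderiv (hseg s)).hasFDerivAt.comp_hasDerivAt s (hline s))
  have hmono : StrictMono fun s : ℝ => fderiv ℝ h (y + s • v) v :=
    strictMono_of_deriv_pos fun s => by rw [(hd2 s).deriv]; exact hpos s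
  obtain ⟨ξ, hξ, hξ'⟩ := exists_hasDerivAt_eq_slope (fun s : ℝ => h (y + s • v))
    (fun s => fderiv ℝ h (y + s • v) v) zero_lt_one
    (fun s _ => (hd1 s).continuousAt.continuousWithinAt) fun s _ => hd1 s
  have hlt := hmono hξ.1
  simp only [hξ', zero_smul, add_zero, one_smul, sub_zero, div_one] at hlt
  rw [hv, map_sub, hh.fderiv_self hy] at hlt
  simp only [add_sub_cancel] at hlt
  linarith

theorem fderiv_apply_le (hh : IsAdmissible h) {y : Euc m} (hy : y ≠ 0) (z : Euc m) :
    fderiv ℝ h y z ≤ h z := by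
  by_cases hz : ∃ c : ℝ, 0 ≤ c ∧ z = c • y
  · obtain ⟨c, hc, rfl⟩ := hz
    rw [map_smul, hh.fderiv_self hy, smul_eq_mul]
    rcases hc.eq_or_lt with rfl | hc
    · simp [hh.map_zero]
    · rw [hh.homog c hc]
  · push Not at hz
    exact (hh.fderiv_apply_lt hy hz).le

theorem inner_polarMap (F : Euc m → ℝ) (y z : Euc m) :
    inner ℝ (polarMap F y) z = ‖y‖ * fderiv ℝ F y z := by
  rw [polarMap, real_inner_smul_left, inner_gradient]

/-- Pairing a common image of `y` and `z` with `y` gives `|y| h(y) = |z| dh_z(y) ≤ |z| h(y)`, so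
`|y| ≤ |z|`, and by symmetry the norms agree. Equality in the tangent inequality then puts `y` on
the ray of `z`. -/
theorem polarMap_injOn (hh : IsAdmissible h) : Set.InjOn (polarMap h) {0}ᶜ := by
  intro y hy z hz hyz
  simp only [Set.mem_compl_iff, Set.mem_singleton_iff] at hy hz
  have key : ∀ y z : Euc m, y ≠ 0 → z ≠ 0 → polarMap h y = polarMap h z → ‖y‖ ≤ ‖z‖ := by
    intro y z hy hz hyz
    have h1 : ‖y‖ * h y = ‖z‖ * fderiv ℝ h z y := by
      rw [← inner_polarMap, ← hyz, inner_polarMap, hh.fderiv_self hy]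
    have h2 := mul_le_mul_of_nonneg_left (hh.fderiv_apply_le hz y) (norm_nonneg z)
    rw [← h1] at h2
    exact le_of_mul_le_mul_right h2 (hh.pos y hy)
  have hnorm : ‖y‖ = ‖z‖ := le_antisymm (key y z hy hz hyz) (key z y hz hy hyz.symm)
  have h1 : ‖y‖ * h y = ‖z‖ * fderiv ℝ h z y := by
    rw [← inner_polarMap, ← hyz, inner_polarMap, hh.fderiv_self hy]
  rw [hnorm] at h1
  have h2 := mul_left_cancel₀ (norm_ne_zero_iff.mpr hz) h1
  by_contra hne
  refine h2.not_gt (hh.fderiv_apply_lt hz ?_)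
  intro c hc hyc
  have h3 : c = 1 := by
    rw [hyc, norm_smul, Real.norm_of_nonneg hc] at hnorm
    exact (mul_eq_right₀ (norm_ne_zero_iff.mpr hz)).mp hnorm
  rw [h3, one_smul] at hyc
  exact hne hyc

/-- Let `L` be the maximum of `⟨x, θ⟩ / h(θ)` over the sphere, attained at `θ`; it is positive, as
the direction of `x` shows. Then `L h - ⟨x, ·⟩` has a local minimum at `θ`, so `x = L ∇h(θ)`. -/
theorem exists_polarMap_eq (hh : IsAdmissible h) {x : Euc m} (hx : x ≠ 0) :
    ∃ y, y ≠ 0 ∧ polarMap h y = x := by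
  have hcont : Continuous fun θ : Sph m => inner ℝ x (θ : Euc m) / h θ := by
    refine Continuous.div (by fun_prop) ?_ fun θ => (hh.pos θ (coe_sph_ne_zero θ)).ne'
    exact hh.continuousOn.comp_continuous continuous_subtype_val fun θ => coe_sph_ne_zero θ
  obtain ⟨r, θx, hr, hxθ⟩ := exists_eq_smul_coe_sph hx
  have : Nonempty (Sph m) := ⟨θx⟩
  obtain ⟨θ, -, hθ⟩ := isCompact_univ.exists_isMaxOn Set.univ_nonempty hcont.continuousOn
  set L : ℝ := inner ℝ x (θ : Euc m) / h θ with hL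
  have hLpos : 0 < L := by
    refine lt_of_lt_of_le ?_ (hθ (Set.mem_univ θx))
    have : inner ℝ x (θx : Euc m) = r := by
      rw [hxθ, real_inner_smul_left, real_inner_self_eq_norm_sq, norm_coe_sph]; ring
    simp only [this]
    exact div_pos hr (hh.pos θx (coe_sph_ne_zero θx))
  have hle : ∀ z : Euc m, z ≠ 0 → inner ℝ x z ≤ L * h z := by
    intro z hz
    obtain ⟨s, η, hs, rfl⟩ := exists_eq_smul_coe_sph hz
    have h1 : inner ℝ x (η : Euc m) / h η ≤ L := hθ (Set.mem_univ η)
    rw [div_le_iff₀ (hh.pos η (coe_sph_ne_zero η))] at h1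
    rw [real_inner_smul_right, hh.homog s hs]
    nlinarith
  have hmin : IsLocalMin (fun z => L * h z - inner ℝ x z) (θ : Euc m) := by
    filter_upwards [isOpen_ne.mem_nhds (coe_sph_ne_zero θ)] with z hz
    have h1 : L * h θ - inner ℝ x (θ : Euc m) = 0 := by
      rw [hL, div_mul_cancel₀ _ (hh.pos θ (coe_sph_ne_zero θ)).ne', sub_self]
    rw [h1]
    linarith [hle z hz]
  have hd : HasFDerivAt (fun z => L * h z - inner ℝ x z)
      (L • fderiv ℝ h (θ : Euc m) - innerSL ℝ x) (θ : Euc m) :=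
    ((hh.differentiableAt (coe_sph_ne_zero θ)).hasFDerivAt.const_mul L).sub
      (innerSL ℝ x).hasFDerivAt
  have h0 := hmin.hasFDerivAt_eq_zero hd
  refine ⟨L • (θ : Euc m), smul_ne_zero hLpos.ne' (coe_sph_ne_zero θ), ?_⟩
  refine ext_inner_right ℝ fun v => ?_
  rw [hh.polarMap_smul hLpos, real_inner_smul_left, inner_polarMap, norm_coe_sph, one_mul]
  have := DFunLike.congr_fun h0 v
  simp at this
  linarith

theorem posDef_hessMatrix (hh : IsAdmissible h) (θ : Sph m) : (hessMatrix h θ).PosDef := by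
  refine Matrix.PosDef.of_dotProduct_mulVec_pos ?_ fun x hx => ?_
  · exact Matrix.IsHermitian.ext fun i j => hh.hess_symm (coe_sph_ne_zero θ) _ _
  · set w : Euc m := ∑ i, x i • frame θ i with hw
    have h1 : inner ℝ (θ : Euc m) w = 0 := by
      simp [hw, inner_sum, inner_smul_right, inner_self_frame]
    have h2 : w ≠ 0 := by
      intro h0
      refine hx (funext fun j => ?_)
      have : inner ℝ (frame θ j) w = x j := by
        simp [hw, inner_sum, inner_smul_right, inner_frame_frame]
      rw [← this, h0]; simp
    have h3 := hh.hess_pos θ w (norm_coe_sph θ) h1 h2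
    refine lt_of_lt_of_eq h3 (Eq.symm ?_)
    simp only [hw, map_sum, map_smul, sum_apply, smul_apply, dotProduct, Matrix.mulVec, hessMatrix,
      Matrix.of_apply, star_trivial, smul_eq_mul, Finset.mul_sum]
    rw [Finset.sum_comm]
    refine Finset.sum_congr rfl fun i _ => Finset.sum_congr rfl fun j _ => ?_
    rw [hh.hess_symm (coe_sph_ne_zero θ)]
    ring

theorem det_hessMatrix_pos (hh : IsAdmissible h) (θ : Sph m) : 0 < (hessMatrix h θ).det :=
  (hh.posDef_hessMatrix θ).det_pos

end IsAdmissible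

/-- The density `h det D²h` of the cone measure, for a general function. -/
noncomputable def coneDensity (h : Euc m → ℝ) (θ : Sph m) : ℝ := h θ * (hessMatrix h θ).det

theorem HomC2.continuous_coe_sph {F : Euc m → ℝ} (hF : HomC2 F) :
    Continuous fun θ : Sph m => F θ :=
  hF.continuousOn.comp_continuous continuous_subtype_val fun θ => coe_sph_ne_zero θ

/-- The matrix of `D²F + θ ⊗ θ` in the standard basis. -/
noncomputable def hessFull (F : Euc m → ℝ) (θ : Sph m) : Matrix (Fin (m + 1)) (Fin (m + 1)) ℝ :=
  Matrix.of fun i j => fderiv ℝ (fderiv ℝ F) (θ : Euc m) (EuclideanSpace.basisFun (Fin (m + 1)) ℝ i)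
        (EuclideanSpace.basisFun (Fin (m + 1)) ℝ j) + (θ : Euc m) i * (θ : Euc m) j

theorem HomC2.continuous_hess {F : Euc m → ℝ} (hF : HomC2 F) :
    Continuous fun θ : Sph m => fderiv ℝ (fderiv ℝ F) (θ : Euc m) :=
  continuous_iff_continuousAt.mpr fun θ =>
    (hF.continuousAt_hess (coe_sph_ne_zero θ)).comp continuous_subtype_val.continuousAt

theorem HomC2.continuous_hessFull {F : Euc m → ℝ} (hF : HomC2 F) : Continuous (hessFull F) := by
  refine continuous_matrix fun i j => ?_
  have h1 := (hF.continuous_hess.clm_apply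
    (continuous_const (y := EuclideanSpace.basisFun (Fin (m + 1)) ℝ i))).clm_apply
    (continuous_const (y := EuclideanSpace.basisFun (Fin (m + 1)) ℝ j))
  have h2 : ∀ i, Continuous fun θ : Sph m => (θ : Euc m) i := fun i => by fun_prop
  exact h1.add ((h2 i).mul (h2 j))

theorem HomC2.det_hessFull {F : Euc m → ℝ} (hF : HomC2 F) (θ : Sph m) :
    (hessFull F θ).det = (hessMatrix F θ).det := det_hess_add θ hF

theorem HomC2.continuous_det_hessMatrix {F : Euc m → ℝ} (hF : HomC2 F) :
    Continuous fun θ => (hessMatrix F θ).det := by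
  simp only [← hF.det_hessFull]
  exact hF.continuous_hessFull.matrix_det

theorem HomC2.continuous_coneDensity {F : Euc m → ℝ} (hF : HomC2 F) : Continuous (coneDensity F) :=
  hF.continuous_coe_sph.mul hF.continuous_det_hessMatrix

theorem IsAdmissible.coneDensity_pos (hh : IsAdmissible h) (θ : Sph m) : 0 < coneDensity h θ :=
  mul_pos (hh.pos θ (coe_sph_ne_zero θ)) (hh.det_hessMatrix_pos θ)

/-- The direction of a nonzero vector. -/
noncomputable def dir (y : ({0}ᶜ : Set (Euc m))) : Sph m := (homeomorphUnitSphereProd (Euc m) y).1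

theorem norm_smul_dir (y : ({0}ᶜ : Set (Euc m))) : ‖(y : Euc m)‖ • (dir y : Euc m) = y := by
  have hy : (y : Euc m) ≠ 0 := y.2
  simp [dir, smul_smul, hy]

theorem HomC2.fderiv_apply_dir {F : Euc m → ℝ} (hF : HomC2 F) (y : ({0}ᶜ : Set (Euc m))) :
    fderiv ℝ F (y : Euc m) (dir y : Euc m) = F (dir y) := by
  conv_lhs => rw [← norm_smul_dir y]
  rw [hF.fderiv_smul (norm_pos_iff.mpr y.2), hF.fderiv_self (coe_sph_ne_zero _)]

open scoped ENNReal in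
/-- Integration of a function of the direction over a star-shaped set, in polar coordinates. -/
theorem lintegral_starShaped {G : Sph m → ℝ≥0∞} (hG : Measurable G) {ρ : Sph m → ℝ}
    (hρ : Measurable ρ) (hρ0 : ∀ θ, 0 < ρ θ) :
    ∫⁻ y in {y : ({0}ᶜ : Set (Euc m)) | ‖(y : Euc m)‖ < ρ (dir y)}, G (dir y)
        ∂((volume : Measure (Euc m)).comap Subtype.val)
      = ∫⁻ θ, G θ * ENNReal.ofReal (ρ θ ^ (m + 1) / ((m : ℝ) + 1))
        ∂((volume : Measure (Euc m)).toSphere) := by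
  have hmp := (volume : Measure (Euc m)).measurePreserving_homeomorphUnitSphereProd
  have hemb : MeasurableEmbedding (homeomorphUnitSphereProd (Euc m)) :=
    (homeomorphUnitSphereProd (Euc m)).measurableEmbedding
  set S : Set (Sph m × Set.Ioi (0 : ℝ)) := {p | (p.2 : ℝ) < ρ p.1} with hS
  have hSm : MeasurableSet S :=
    measurableSet_lt (measurable_subtype_coe.comp measurable_snd) (hρ.comp measurable_fst)
  have h1 : {y : ({0}ᶜ : Set (Euc m)) | ‖(y : Euc m)‖ < ρ (dir y)}
      = homeomorphUnitSphereProd (Euc m) ⁻¹' S := by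
    ext y; simp [hS, dir]
  rw [h1]
  have h2 := hmp.setLIntegral_comp_preimage_emb hemb (fun p => G p.1) S
  refine h2.trans ?_
  rw [← lintegral_indicator hSm]
  refine (lintegral_prod _ ((hG.comp measurable_fst).indicator hSm).aemeasurable).trans ?_
  refine lintegral_congr fun θ => ?_
  have h3 : ∀ r : Set.Ioi (0 : ℝ), S.indicator (fun p => G p.1) (θ, r)
      = (Set.Iio (⟨ρ θ, hρ0 θ⟩ : Set.Ioi (0 : ℝ))).indicator (fun _ => G θ) r := by
    intro r
    simp only [Set.indicator_apply, hS, Set.mem_ofPred_eq, Set.mem_Iio, ← Subtype.coe_lt_coe]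
  refine (lintegral_congr h3).trans ?_
  rw [lintegral_indicator_const measurableSet_Iio, Measure.volumeIoiPow_apply_Iio]
  simp

/-- The interior of the Wulff shape of a function. -/
def wulff (k : Euc m → ℝ) : Set (Euc m) := {x | ∀ θ : Sph m, inner ℝ x (θ : Euc m) < k θ}

theorem isOpen_wulff (hk : Continuous fun θ : Sph m => k θ) : IsOpen (wulff k) := by
  have h1 : IsClosed {p : Euc m × Sph m | k p.2 ≤ inner ℝ p.1 (p.2 : Euc m)} :=
    isClosed_le (hk.comp continuous_snd) (by fun_prop)
  have h2 := isClosedMap_fst_of_compactSpace _ h1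
  rw [← isClosed_compl_iff]
  convert h2 using 1
  ext x
  simp [wulff]

/-- Change of variables under an injective map whose Jacobian depends on the direction only,
followed by polar coordinates. The choices `ρ = 1` and `ρ = k / h` give the lower and the upper
volume bounds below. -/
theorem volume_image_polarMap (hh : IsAdmissible h) {ρ : Sph m → ℝ} (hρ : Measurable ρ)
    (hρ0 : ∀ θ, 0 < ρ θ) :
    volume (polarMap h '' (Subtype.val '' {y : ({0}ᶜ : Set (Euc m)) | ‖(y : Euc m)‖ < ρ (dir y)}))
      = ∫⁻ θ, ENNReal.ofReal (coneDensity h θ * (ρ θ ^ (m + 1) / ((m : ℝ) + 1)))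
        ∂((volume : Measure (Euc m)).toSphere) := by
  have hemb : MeasurableEmbedding (Subtype.val : ({0}ᶜ : Set (Euc m)) → Euc m) :=
    MeasurableEmbedding.subtype_coe (measurableSet_singleton _).compl
  have hdir : Measurable (dir : ({0}ᶜ : Set (Euc m)) → Sph m) :=
    (continuous_fst.comp (homeomorphUnitSphereProd (Euc m)).continuous).measurable
  set S : Set ({0}ᶜ : Set (Euc m)) := {y | ‖(y : Euc m)‖ < ρ (dir y)} with hS
  have hSm : MeasurableSet S :=
    measurableSet_lt (by fun_prop) (hρ.comp hdir)
  have hne : ∀ y ∈ (Subtype.val '' S : Set (Euc m)), y ≠ 0 := by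
    rintro _ ⟨y, -, rfl⟩; exact y.2
  rw [← lintegral_abs_det_fderiv_eq_addHaar_image volume (hemb.measurableSet_image' hSm)
    (fun y hy => (hh.differentiableAt_polarMap (hne y hy)).hasFDerivAt.hasFDerivWithinAt)
    (hh.polarMap_injOn.mono fun y hy => hne y hy)]
  have h2 : ∫⁻ y in (Subtype.val '' S : Set (Euc m)),
        ENNReal.ofReal |(fderiv ℝ (polarMap h) y).det|
      = ∫⁻ y in S, ENNReal.ofReal |(fderiv ℝ (polarMap h) (y : Euc m)).det|
        ∂((volume : Measure (Euc m)).comap Subtype.val) :=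
    (setLIntegral_subtype (measurableSet_singleton _).compl S _).symm
  rw [h2]
  have h3 : ∀ y : ({0}ᶜ : Set (Euc m)), |(fderiv ℝ (polarMap h) (y : Euc m)).det|
      = coneDensity h (dir y) := by
    intro y
    conv_lhs => rw [← norm_smul_dir y]
    rw [hh.fderiv_polarMap_smul (norm_pos_iff.mpr y.2) (coe_sph_ne_zero _),
      hh.det_fderiv_polarMap]
    exact abs_of_pos (hh.coneDensity_pos _)
  simp only [h3]
  rw [lintegral_starShaped (G := fun θ => ENNReal.ofReal (coneDensity h θ))
    hh.continuous_coneDensity.measurable.ennreal_ofReal hρ hρ0]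
  refine lintegral_congr fun θ => ?_
  rw [ENNReal.ofReal_mul (hh.coneDensity_pos θ).le]

/-- The points `r ∇h(θ)` with `0 < r < 1` satisfy every constraint of the Wulff shape, by the
tangent inequality. -/
theorem IsAdmissible.le_volume_wulff (hh : IsAdmissible h) :
    ∫⁻ θ, ENNReal.ofReal (coneDensity h θ * (1 ^ (m + 1) / ((m : ℝ) + 1)))
        ∂((volume : Measure (Euc m)).toSphere) ≤ volume (wulff h) := by
  rw [← volume_image_polarMap hh (ρ := fun _ => 1) measurable_const fun _ => one_pos]
  refine measure_mono ?_
  rintro _ ⟨_, ⟨y, hy, rfl⟩, rfl⟩ θ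
  have h1 := hh.fderiv_apply_le y.2 (θ : Euc m)
  have h2 := hh.pos θ (coe_sph_ne_zero θ)
  have h3 : ‖(y : Euc m)‖ < 1 := hy
  rw [IsAdmissible.inner_polarMap]
  nlinarith [norm_nonneg (y : Euc m), norm_pos_iff.mpr y.2]

/-- A nonzero point has the form `r ∇h(θ)`, and its constraint in the single direction `θ` reads `r
h(θ) < k(θ)`. Ignoring the other constraints loses nothing when `k = h`. -/
theorem IsAdmissible.volume_wulff_le (hh : IsAdmissible h) (hk : Continuous fun θ : Sph m => k θ)
    (hk0 : ∀ θ : Sph m, 0 < k θ) :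
    volume (wulff k) ≤ ∫⁻ θ, ENNReal.ofReal (coneDensity h θ * ((k θ / h θ) ^ (m + 1) /
      ((m : ℝ) + 1))) ∂((volume : Measure (Euc m)).toSphere) := by
  rw [← volume_image_polarMap hh (ρ := fun θ => k θ / h θ)
    (hk.measurable.div hh.continuous_coe_sph.measurable)
    fun θ => div_pos (hk0 θ) (hh.pos θ (coe_sph_ne_zero θ))]
  have h1 : volume (wulff k) = volume (wulff k \ {0}) :=
    (measure_sdiff_null (measure_singleton _)).symm
  rw [h1]
  refine measure_mono ?_
  rintro x ⟨hx, hx0⟩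
  obtain ⟨y, hy, rfl⟩ := hh.exists_polarMap_eq hx0
  refine ⟨y, ⟨⟨y, hy⟩, ?_, rfl⟩, rfl⟩
  have h2 := hx (dir ⟨y, hy⟩)
  rw [IsAdmissible.inner_polarMap, hh.fderiv_apply_dir ⟨y, hy⟩] at h2
  exact (lt_div_iff₀ (hh.pos _ (coe_sph_ne_zero _))).mpr h2

end CentroAffine

/-! ### Perturbations, derivatives of determinants, and the second-derivative test -/

namespace CentroAffine

variable {m : ℕ} {h z : Euc m → ℝ}

theorem exists_forall_abs_lt_pos {X : Type*} [TopologicalSpace X] [CompactSpace X] {a b : X → ℝ}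
    (ha : Continuous a) (hb : Continuous b) (ha0 : ∀ x, 0 < a x) :
    ∃ ε : ℝ, 0 < ε ∧ ∀ t, |t| < ε → ∀ x, 0 < a x + t * b x := by
  rcases isEmpty_or_nonempty X with hX | hX
  · exact ⟨1, one_pos, fun _ _ x => hX.elim x⟩
  obtain ⟨x₀, -, hx₀⟩ := isCompact_univ.exists_isMinOn Set.univ_nonempty ha.continuousOn
  obtain ⟨x₁, -, hx₁⟩ := isCompact_univ.exists_isMaxOn Set.univ_nonempty hb.abs.continuousOn
  have hC : 0 < |b x₁| + 1 := by positivity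
  refine ⟨a x₀ / (|b x₁| + 1), div_pos (ha0 x₀) hC, fun t ht x => ?_⟩
  have h1 : a x₀ ≤ a x := hx₀ (Set.mem_univ x)
  have h2 : |b x| ≤ |b x₁| := hx₁ (Set.mem_univ x)
  rw [lt_div_iff₀ hC] at ht
  have h3 : |t * b x| ≤ |t| * (|b x₁| + 1) := by
    rw [abs_mul]
    exact mul_le_mul_of_nonneg_left (by linarith) (abs_nonneg t)
  linarith [neg_abs_le (t * b x)]

theorem HomC2.add_smul {F G : Euc m → ℝ} (hF : HomC2 F) (hG : HomC2 G) (t : ℝ) :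
    HomC2 fun y => F y + t * G y :=
  hF.add (hG.const_mul t)

theorem HomC2.hess_add_smul {F G : Euc m → ℝ} (hF : HomC2 F) (hG : HomC2 G) (t : ℝ) {y : Euc m}
    (hy : y ≠ 0) : fderiv ℝ (fderiv ℝ fun y => F y + t * G y) y
      = fderiv ℝ (fderiv ℝ F) y + t • fderiv ℝ (fderiv ℝ G) y := by
  rw [hF.hess_add (hG.const_mul t) hy, hG.hess_const_mul t hy]

/-- Admissibility is stable under small perturbations. -/
theorem IsAdmissible.exists_perturb (hh : IsAdmissible h) (hz : HomC2 z) :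
    ∃ ε : ℝ, 0 < ε ∧ ∀ t, |t| < ε → IsAdmissible fun y => h y + t * z y := by
  obtain ⟨ε₁, hε₁, h₁⟩ := exists_forall_abs_lt_pos hh.continuous_coe_sph hz.continuous_coe_sph
    fun θ => hh.pos θ (coe_sph_ne_zero θ)
  -- Positivity of the tangential Hessian is tested on the compact set of orthogonal pairs of unit
  -- vectors, so one `ε` serves all of them.
  let Q : Set (Sph m × Sph m) := {p | inner ℝ (p.1 : Euc m) (p.2 : Euc m) = 0}
  have hQ : IsClosed Q := isClosed_eq (by fun_prop) continuous_const
  have : CompactSpace Q := isCompact_iff_compactSpace.mp hQ.isCompact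
  have hcont : ∀ F : Euc m → ℝ, HomC2 F → Continuous fun p : Q =>
      fderiv ℝ (fderiv ℝ F) (p.1.1 : Euc m) (p.1.2 : Euc m) (p.1.2 : Euc m) := by
    intro F hF
    have h1 : Continuous fun p : Q => fderiv ℝ (fderiv ℝ F) (p.1.1 : Euc m) :=
      hF.continuous_hess.comp (by fun_prop)
    have h2 : Continuous fun p : Q => (p.1.2 : Euc m) := by fun_prop
    exact (h1.clm_apply h2).clm_apply h2
  obtain ⟨ε₂, hε₂, h₂⟩ := exists_forall_abs_lt_pos (hcont h hh.toHomC2) (hcont z hz)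
    fun p => hh.hess_pos _ _ (norm_coe_sph _) p.2 (coe_sph_ne_zero _)
  refine ⟨min ε₁ ε₂, lt_min hε₁ hε₂, fun t ht => ⟨hh.toHomC2.add_smul hz t, ?_, ?_⟩⟩
  · intro y hy
    obtain ⟨r, θ, hr, rfl⟩ := exists_eq_smul_coe_sph hy
    have := h₁ t (ht.trans_le (min_le_left _ _)) θ
    rw [hh.homog r hr, hz.homog r hr]
    nlinarith
  · intro θ w hθ hw hw0
    obtain ⟨r, η, hr, rfl⟩ := exists_eq_smul_coe_sph hw0
    rw [inner_smul_right, mul_eq_zero, or_iff_right hr.ne'] at hw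
    have h3 := h₂ t (ht.trans_le (min_le_right _ _))
      ⟨(⟨θ, mem_sphere_zero_iff_norm.mpr hθ⟩, η), hw⟩
    simp only at h3
    have hθ0 : θ ≠ 0 := by
      rintro rfl
      simp at hθ
    rw [hh.toHomC2.hess_add_smul hz t hθ0]
    simp only [map_smul, smul_apply, add_apply, smul_eq_mul]
    have h4 := mul_pos (mul_pos hr hr) h3
    linarith

theorem HomC2.hessMatrix_add_smul {F G : Euc m → ℝ} (hF : HomC2 F) (hG : HomC2 G) (t : ℝ)
    (θ : Sph m) : hessMatrix (fun y => F y + t * G y) θ = hessMatrix F θ + t • hessMatrix G θ := by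
  ext i j
  simp [hessMatrix, hF.hess_add_smul hG t (coe_sph_ne_zero θ)]

theorem hasDerivAt_det_one_add_smul {ι : Type*} [Fintype ι] [DecidableEq ι] (M : Matrix ι ι ℝ) :
    HasDerivAt (fun t : ℝ => (1 + t • M).det) M.trace 0 := by
  rw [funext fun t : ℝ => Matrix.det_one_add_smul t M]
  generalize (Matrix.det (1 + (Polynomial.X : Polynomial ℝ) • M.map Polynomial.C)).divX.divX = p
  have hp := (p.hasDerivAt 0).fun_mul (hasDerivAt_pow 2 (0 : ℝ))
  have hl := ((hasDerivAt_id (0 : ℝ)).const_mul M.trace).const_add 1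
  exact (hl.fun_add hp).congr_deriv (by simp)

/-- Jacobi's formula, reduced to the identity matrix by factoring out `A + s B`. The adjugate form
is polynomial in the entries, so the derivative is jointly continuous in `s` and in the matrices. -/
theorem hasDerivAt_det_add_smul {ι : Type*} [Fintype ι] [DecidableEq ι] (A B : Matrix ι ι ℝ)
    (s : ℝ) (hA : (A + s • B).det ≠ 0) :
    HasDerivAt (fun t : ℝ => (A + t • B).det) ((A + s • B).adjugate * B).trace s := by
  set M := A + s • B with hM
  have hu : IsUnit M.det := isUnit_iff_ne_zero.mpr hA
  have h1 : ∀ t : ℝ, (A + t • B).det = M.det * (1 + (t - s) • (M⁻¹ * B)).det := by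
    intro t
    rw [← Matrix.det_mul, mul_add, mul_one, Matrix.mul_smul, Matrix.mul_nonsing_inv_cancel_left _ _ hu,
      hM]
    congr 1
    module
  have h2 : ((M.adjugate) * B).trace = M.det * (M⁻¹ * B).trace := by
    rw [Matrix.inv_def, Matrix.smul_mul, Matrix.trace_smul, Ring.inverse_eq_inv', smul_eq_mul,
      mul_inv_cancel_left₀ hA]
  rw [h2, funext h1]
  refine HasDerivAt.const_mul _ ?_
  have h3 := hasDerivAt_det_one_add_smul (M⁻¹ * B)
  rw [← sub_self s] at h3
  simpa [Function.comp_def] using h3.scomp (h := fun t => t - s) s ((hasDerivAt_id s).sub_const s)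

theorem trace_adjugate_mul_eq {ι : Type*} [Fintype ι] [DecidableEq ι] {A B : Matrix ι ι ℝ}
    (hA : A.det ≠ 0) : (A.adjugate * B).trace = A.det * (A⁻¹ * B).trace := by
  rw [Matrix.inv_def, Matrix.smul_mul, Matrix.trace_smul, Ring.inverse_eq_inv', smul_eq_mul,
    mul_inv_cancel_left₀ hA]

/-- The matrix of `D²F` in the standard basis. -/
noncomputable def hessStd (F : Euc m → ℝ) (θ : Sph m) : Matrix (Fin (m + 1)) (Fin (m + 1)) ℝ :=
  Matrix.of fun i j => fderiv ℝ (fderiv ℝ F) (θ : Euc m)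
    (EuclideanSpace.basisFun (Fin (m + 1)) ℝ i) (EuclideanSpace.basisFun (Fin (m + 1)) ℝ j)

theorem HomC2.continuous_hessStd {F : Euc m → ℝ} (hF : HomC2 F) : Continuous (hessStd F) := by
  refine continuous_matrix fun i j => ?_
  exact (hF.continuous_hess.clm_apply
    (continuous_const (y := EuclideanSpace.basisFun (Fin (m + 1)) ℝ i))).clm_apply
    (continuous_const (y := EuclideanSpace.basisFun (Fin (m + 1)) ℝ j))

theorem HomC2.hessFull_add_smul {F G : Euc m → ℝ} (hF : HomC2 F) (hG : HomC2 G) (t : ℝ)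
    (θ : Sph m) : hessFull (fun y => F y + t * G y) θ = hessFull F θ + t • hessStd G θ := by
  ext i j
  simp [hessFull, hessStd, hF.hess_add_smul hG t (coe_sph_ne_zero θ)]
  ring

/-- The derivative of `det D²(h + t z)` in `t`. -/
noncomputable def detDeriv (h z : Euc m → ℝ) (t : ℝ) (θ : Sph m) : ℝ :=
  ((hessFull h θ + t • hessStd z θ).adjugate * hessStd z θ).trace

theorem continuous_detDeriv (hh : HomC2 h) (hz : HomC2 z) :
    Continuous (Function.uncurry (detDeriv h z)) := by
  have h1 : Continuous fun p : ℝ × Sph m => hessFull h p.2 + p.1 • hessStd z p.2 :=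
    (hh.continuous_hessFull.comp continuous_snd).add
      (continuous_fst.smul (hz.continuous_hessStd.comp continuous_snd))
  exact (h1.matrix_adjugate.matrix_mul (hz.continuous_hessStd.comp continuous_snd)).matrix_trace

theorem hasDerivAt_det_hessMatrix (hh : HomC2 h) (hz : HomC2 z) {s : ℝ}
    (hs : IsAdmissible fun y => h y + s * z y) (θ : Sph m) :
    HasDerivAt (fun t => (hessMatrix (fun y => h y + t * z y) θ).det) (detDeriv h z s θ) s := by
  have h1 : (hessFull h θ + s • hessStd z θ).det ≠ 0 := by
    rw [← hh.hessFull_add_smul hz, hs.det_hessFull]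
    exact (hs.det_hessMatrix_pos θ).ne'
  have h2 := hasDerivAt_det_add_smul _ _ s h1
  simpa only [detDeriv, ← hh.hessFull_add_smul hz, (hh.add_smul hz _).det_hessFull] using h2

/-- Passage from the standard basis to the frame: both sides are the derivative at 0 of the same
function `det D²(h + t z)`. -/
theorem detDeriv_zero (hh : IsAdmissible h) (hz : HomC2 z) (θ : Sph m) :
    detDeriv h z 0 θ = (hessMatrix h θ).det * ((hessMatrix h θ)⁻¹ * hessMatrix z θ).trace := by
  have h0 : IsAdmissible fun y => h y + 0 * z y := by simpa using hh
  have h1 := hasDerivAt_det_hessMatrix hh.toHomC2 hz h0 θ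
  simp only [hh.toHomC2.hessMatrix_add_smul hz] at h1
  have hd := (hh.det_hessMatrix_pos θ).ne'
  have h2 := hasDerivAt_det_add_smul (hessMatrix h θ) (hessMatrix z θ) 0 (by simpa using hd)
  rw [h1.unique h2]
  simp only [zero_smul, add_zero]
  exact trace_adjugate_mul_eq hd

theorem hasDerivAt_integral_of_compactSpace {X : Type*} [TopologicalSpace X] [CompactSpace X]
    [MeasurableSpace X] [BorelSpace X] {μ : Measure X} [IsFiniteMeasure μ]
    {F F' : ℝ → X → ℝ} {ε : ℝ} (hF : ∀ t, |t| < ε → Continuous (F t))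
    (hF' : Continuous (Function.uncurry F'))
    (hd : ∀ t, |t| < ε → ∀ x, HasDerivAt (fun t => F t x) (F' t x) t) {s : ℝ} (hs : |s| < ε) :
    HasDerivAt (fun t => ∫ x, F t x ∂μ) (∫ x, F' s x ∂μ) s := by
  have hnhds : {t : ℝ | |t| < ε} ∈ 𝓝 s := (isOpen_lt continuous_abs continuous_const).mem_nhds hs
  have hint : ∀ u : X → ℝ, Continuous u → Integrable u μ := fun u hu =>
    hu.integrable_of_hasCompactSupport (HasCompactSupport.of_compactSpace u)
  obtain ⟨C, hC⟩ := ((isCompact_Icc (a := -ε) (b := ε)).prod (isCompact_univ (X := X))).exists_bound_of_continuousOn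
    hF'.continuousOn
  refine (hasDerivAt_integral_of_dominated_loc_of_deriv_le (bound := fun _ => C) hnhds ?_
    (hint _ (hF s hs)) ?_ ?_ (integrable_const C) ?_).2
  · filter_upwards [hnhds] with t ht
    exact (hint _ (hF t ht)).aestronglyMeasurable
  · exact (hint _ (hF'.comp (by fun_prop : Continuous fun x => (s, x)))).aestronglyMeasurable
  · refine ae_of_all _ fun x t ht => hC (t, x) ⟨?_, Set.mem_univ x⟩
    exact ⟨(abs_lt.mp ht).1.le, (abs_lt.mp ht).2.le⟩
  · exact ae_of_all _ fun x t ht => hd t ht x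

/-- The derivative `Q` vanishes at 0 with positive slope, so `P` increases just to the right. This
serves both the volume functional and the uniqueness of contact points. -/
theorem eventually_lt_of_second_deriv_pos {P Q : ℝ → ℝ} {u : ℝ}
    (hP : ∀ᶠ t in 𝓝 (0 : ℝ), HasDerivAt P (Q t) t) (hQ : HasDerivAt Q u 0) (hQ0 : Q 0 = 0)
    (hu : 0 < u) : ∀ᶠ t in 𝓝[>] (0 : ℝ), P 0 < P t := by
  have hev : ∀ᶠ t in 𝓝[>] (0 : ℝ), 0 < Q t := by
    have h1 := (hasDerivAt_iff_tendsto_slope.mp hQ).eventually (lt_mem_nhds hu)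
    have h2 : 𝓝[>] (0 : ℝ) ≤ 𝓝[≠] 0 := nhdsWithin_mono 0 fun t ht => ne_of_gt ht
    filter_upwards [h2 h1, self_mem_nhdsWithin] with t ht ht0
    rw [slope_def_field, hQ0, sub_zero, sub_zero] at ht
    exact (div_pos_iff_of_pos_right ht0).mp ht
  obtain ⟨δ, hδ, hδ'⟩ := mem_nhdsGT_iff_exists_Ioo_subset.mp
    (hev.and (mem_nhdsWithin_of_mem_nhds hP))
  filter_upwards [Ioo_mem_nhdsGT hδ] with r hr
  have hd : ∀ t ∈ Set.Icc 0 r, HasDerivAt P (Q t) t := by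
    intro t ht
    rcases ht.1.eq_or_lt with rfl | ht0
    · exact hP.self_of_nhds
    · exact (hδ' ⟨ht0, ht.2.trans_lt hr.2⟩).2
  have hmono : StrictMonoOn P (Set.Icc 0 r) := by
    refine strictMonoOn_of_deriv_pos (convex_Icc 0 r)
      (fun t ht => (hd t ht).continuousAt.continuousWithinAt) fun t ht => ?_
    rw [interior_Icc] at ht
    rw [(hd t ⟨ht.1.le, ht.2.le⟩).deriv]
    exact (hδ' ⟨ht.1, ht.2.trans hr.2⟩).1
  exact hmono ⟨le_rfl, hr.1.le⟩ ⟨hr.1.le, le_rfl⟩ hr.1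

/-- The second-derivative test for `V(t) V(-t) ≤ V(0)²` at a critical point of `V`. -/
theorem second_deriv_nonpos {V U : ℝ → ℝ} {ε u : ℝ} (hε : 0 < ε)
    (hV : ∀ t, |t| < ε → HasDerivAt V (U t) t) (hU : HasDerivAt U u 0)
    (hmax : ∀ t, |t| < ε → V t * V (-t) ≤ V 0 ^ 2) (hV0 : 0 < V 0) (hU0 : U 0 = 0) : u ≤ 0 := by
  by_contra! hu
  -- If `u > 0`, then `P' = Q` with `Q(0) = 0` and `Q'(0) = 2 u V(0) > 0`, so `P` exceeds `P(0) =
  -- V(0)²` at small `t > 0`.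
  set P : ℝ → ℝ := fun t => V t * V (-t) with hP
  set Q : ℝ → ℝ := fun t => U t * V (-t) - V t * U (-t) with hQ
  have hPd : ∀ t, |t| < ε → HasDerivAt P (Q t) t := by
    intro t ht
    have h1 : HasDerivAt (fun t => V (-t)) (-U (-t)) t := by
      have := (hV (-t) (by simpa using ht)).scomp t (hasDerivAt_neg t)
      simpa [Function.comp_def] using this
    refine ((hV t ht).fun_mul h1).congr_deriv ?_
    simp only [hQ]; ring
  have hQd : HasDerivAt Q (2 * u * V 0) 0 := by
    have h1 : HasDerivAt (fun t => V (-t)) (-U 0) 0 := by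
      have h0 : HasDerivAt V (U 0) (-0) := by simpa using hV 0 (by simpa using hε)
      simpa [Function.comp_def] using h0.scomp (0 : ℝ) (hasDerivAt_neg (0 : ℝ))
    have h2 : HasDerivAt (fun t => U (-t)) (-u) 0 := by
      have h0 : HasDerivAt U u (-0) := by simpa using hU
      simpa [Function.comp_def] using h0.scomp (0 : ℝ) (hasDerivAt_neg (0 : ℝ))
    refine ((hU.fun_mul h1).fun_sub ((hV 0 (by simpa using hε)).fun_mul h2)).congr_deriv ?_
    simp [hU0]; ring
  have hQ0 : Q 0 = 0 := by simp [hQ, hU0]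
  have hpos : 0 < 2 * u * V 0 := by positivity
  have hnhds : {t : ℝ | |t| < ε} ∈ 𝓝 0 :=
    (isOpen_lt continuous_abs continuous_const).mem_nhds (by simpa using hε)
  have hev := eventually_lt_of_second_deriv_pos (by filter_upwards [hnhds] with t ht using hPd t ht)
    hQd hQ0 hpos
  obtain ⟨r, h1, h2⟩ := (hev.and (mem_nhdsWithin_of_mem_nhds hnhds)).exists
  have h3 := hmax r h2
  simp only [hP, neg_zero] at h1
  linarith [sq (V 0)]

end CentroAffine

/-! ### First and second variation of the volume -/

namespace CentroAffine

variable {m : ℕ} {h k z : Euc m → ℝ}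

/-- The surface measure of the unit sphere. -/
noncomputable abbrev sphMeasure (m : ℕ) : Measure (Sph m) := (volume : Measure (Euc m)).toSphere

theorem integrable_of_continuous {X : Type*} [TopologicalSpace X] [CompactSpace X]
    [MeasurableSpace X] [BorelSpace X] {μ : Measure X} [IsFiniteMeasure μ] {u : X → ℝ}
    (hu : Continuous u) : Integrable u μ :=
  hu.integrable_of_hasCompactSupport (HasCompactSupport.of_compactSpace u)

/-- The volume `∫ h det D²h` of the body with support function `h`, multiplied by `n`. -/
noncomputable def coneVol (h : Euc m → ℝ) : ℝ := ∫ θ, coneDensity h θ ∂(sphMeasure m)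

theorem IsAdmissible.coneVol_pos (hh : IsAdmissible h) : 0 < coneVol h := by
  refine (integral_pos_iff_support_of_nonneg (fun θ => (hh.coneDensity_pos θ).le)
    (integrable_of_continuous hh.continuous_coneDensity)).mpr ?_
  have : Function.support (coneDensity h) = Set.univ := by
    ext θ
    simpa using (hh.coneDensity_pos θ).ne'
  rw [this]
  exact Measure.measure_univ_pos.mpr (Measure.toSphere_ne_zero _)

theorem IsAdmissible.volume_wulff_le_ofReal (hh : IsAdmissible h)
    (hk : Continuous fun θ : Sph m => k θ) (hk0 : ∀ θ : Sph m, 0 < k θ) :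
    volume (wulff k) ≤ ENNReal.ofReal
      ((∫ θ : Sph m, coneDensity h θ * (k θ / h θ) ^ (m + 1) ∂(sphMeasure m)) / ((m : ℝ) + 1)) := by
  refine (hh.volume_wulff_le hk hk0).trans_eq ?_
  have hc : Continuous fun θ : Sph m => coneDensity h θ * ((k θ / h θ) ^ (m + 1) / ((m : ℝ) + 1)) :=
    hh.continuous_coneDensity.mul (((hk.div hh.continuous_coe_sph
      fun θ => (hh.pos θ (coe_sph_ne_zero θ)).ne').pow _).div_const _)
  rw [← ofReal_integral_eq_lintegral_ofReal (integrable_of_continuous hc), ← integral_div]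
  · simp only [mul_div_assoc]
  · refine ae_of_all _ fun θ => ?_
    have h1 := hh.pos θ (coe_sph_ne_zero θ)
    have h2 := hk0 θ
    have h3 := hh.coneDensity_pos θ
    simp only [Pi.zero_apply]
    positivity

theorem IsAdmissible.ofReal_le_volume_wulff (hh : IsAdmissible h) :
    ENNReal.ofReal (coneVol h / ((m : ℝ) + 1)) ≤ volume (wulff h) := by
  refine le_trans (le_of_eq ?_) hh.le_volume_wulff
  rw [← ofReal_integral_eq_lintegral_ofReal, coneVol, ← integral_div]
  · simp [div_eq_mul_inv]
  · exact integrable_of_continuous (hh.continuous_coneDensity.mul continuous_const)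
  · refine ae_of_all _ fun θ => ?_
    have h3 := hh.coneDensity_pos θ
    simp only [Pi.zero_apply]
    positivity

/-- The volume of the Wulff shape of `k` is bounded below through `k` itself and above through the
parametrization by `∇h`. Equality at `k = h` makes this the source of the first variation formula.
-/
theorem IsAdmissible.coneVol_le (hh : IsAdmissible h) (hk : IsAdmissible k) :
    coneVol k ≤ ∫ θ : Sph m, coneDensity h θ * (k θ / h θ) ^ (m + 1) ∂(sphMeasure m) := by
  have h1 := hk.ofReal_le_volume_wulff.trans (hh.volume_wulff_le_ofReal hk.continuous_coe_sph
    fun θ => hk.pos θ (coe_sph_ne_zero θ))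
  have hn : (0 : ℝ) < (m : ℝ) + 1 := by positivity
  by_contra! hlt
  have h2 : 0 < coneVol k / ((m : ℝ) + 1) := div_pos hk.coneVol_pos hn
  rw [ENNReal.ofReal_le_ofReal_iff'] at h1
  rcases h1 with h1 | h1
  · rw [div_le_div_iff_of_pos_right hn] at h1
    linarith
  · linarith

/-- Wulff constraints are linear in the point, so midpoints of the shapes of `h₁` and `h₂` lie in
that of `h`, and Brunn–Minkowski applies. -/
theorem coneVol_mul_coneVol_le {h₁ h₂ : Euc m → ℝ} (hh : IsAdmissible h) (hh₁ : IsAdmissible h₁)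
    (hh₂ : IsAdmissible h₂) (hmid : ∀ y, h₁ y + h₂ y = 2 * h y) :
    coneVol h₁ * coneVol h₂ ≤ coneVol h ^ 2 := by
  have hn : (0 : ℝ) < (m : ℝ) + 1 := by positivity
  have h1 := volume_mul_volume_le (isOpen_wulff hh₁.continuous_coe_sph).measurableSet
    (isOpen_wulff hh₂.continuous_coe_sph).measurableSet
    (isOpen_wulff hh.continuous_coe_sph).measurableSet (fun x hx y hy θ => by
      have h3 := hx θ
      have h4 := hy θ
      rw [real_inner_smul_left, inner_add_left]
      linarith [hmid θ])
  have h2 := (mul_le_mul' hh₁.ofReal_le_volume_wulff hh₂.ofReal_le_volume_wulff).trans h1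
  have h3 : volume (wulff h) ≤ ENNReal.ofReal (coneVol h / ((m : ℝ) + 1)) := by
    refine (hh.volume_wulff_le_ofReal hh.continuous_coe_sph
      fun θ => hh.pos θ (coe_sph_ne_zero θ)).trans_eq ?_
    congr 2
    refine integral_congr_ae (ae_of_all _ fun θ => ?_)
    simp [div_self (hh.pos θ (coe_sph_ne_zero θ)).ne']
  have hp := div_pos hh.coneVol_pos hn
  have hp₁ := div_pos hh₁.coneVol_pos hn
  have hp₂ := div_pos hh₂.coneVol_pos hn
  have h4 := h2.trans (pow_le_pow_left' h3 2)
  rw [← ENNReal.ofReal_mul hp₁.le, ← ENNReal.ofReal_pow hp.le,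
    ENNReal.ofReal_le_ofReal_iff (by positivity), div_mul_div_comm, div_pow, ← sq,
    div_le_div_iff_of_pos_right (by positivity)] at h4
  exact h4

/-- The derivative of the cone density of `h + t z`, by the product rule. -/
noncomputable def coneDensityDeriv (h z : Euc m → ℝ) (t : ℝ) (θ : Sph m) : ℝ :=
  z θ * (hessFull h θ + t • hessStd z θ).det + (h θ + t * z θ) * detDeriv h z t θ

theorem continuous_coneDensityDeriv (hh : HomC2 h) (hz : HomC2 z) :
    Continuous (Function.uncurry (coneDensityDeriv h z)) := by
  have h1 : Continuous fun p : ℝ × Sph m => hessFull h p.2 + p.1 • hessStd z p.2 :=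
    (hh.continuous_hessFull.comp continuous_snd).add
      (continuous_fst.smul (hz.continuous_hessStd.comp continuous_snd))
  have h2 := hh.continuous_coe_sph.comp (continuous_snd (X := ℝ))
  have h3 := hz.continuous_coe_sph.comp (continuous_snd (X := ℝ))
  exact (h3.mul h1.matrix_det).add ((h2.add (continuous_fst.mul h3)).mul
    (continuous_detDeriv hh hz))

theorem hasDerivAt_coneVol {ε : ℝ} (hh : HomC2 h) (hz : HomC2 z)
    (hε : ∀ t, |t| < ε → IsAdmissible fun y => h y + t * z y) {s : ℝ} (hs : |s| < ε) :
    HasDerivAt (fun t => coneVol fun y => h y + t * z y)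
      (∫ θ, coneDensityDeriv h z s θ ∂(sphMeasure m)) s := by
  refine hasDerivAt_integral_of_compactSpace (ε := ε) (F' := coneDensityDeriv h z)
    (fun t _ => (hh.add_smul hz t).continuous_coneDensity)
    (continuous_coneDensityDeriv hh hz) (fun t ht θ => ?_) hs
  have h1 := hasDerivAt_det_hessMatrix hh hz (hε t ht) θ
  have h2 : HasDerivAt (fun t => h θ + t * z θ) (z θ) t := by
    simpa using ((hasDerivAt_id t).mul_const (z θ)).const_add (h θ)
  refine (h2.fun_mul h1).congr_deriv ?_
  rw [coneDensityDeriv, ← hh.hessFull_add_smul hz, (hh.add_smul hz t).det_hessFull]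

/-- The first variation of the volume. -/
theorem integral_coneDensityDeriv {ε : ℝ} (hh : HomC2 h) (hz : HomC2 z)
    (hε : ∀ t, |t| < ε → IsAdmissible fun y => h y + t * z y) {s : ℝ} (hs : |s| < ε) :
    ∫ θ, coneDensityDeriv h z s θ ∂(sphMeasure m) = ((m : ℝ) + 1) *
      ∫ θ : Sph m, z θ * (hessMatrix (fun y => h y + s * z y) θ).det ∂(sphMeasure m) := by
  have hs' := hε s hs
  set k : Euc m → ℝ := fun y => h y + s * z y with hk
  have hkpos : ∀ θ : Sph m, 0 < k θ := fun θ => hs'.pos θ (coe_sph_ne_zero θ)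
  set F : ℝ → Sph m → ℝ := fun t θ => coneDensity k θ * ((h θ + t * z θ) / k θ) ^ (m + 1) with hF
  set F' : ℝ → Sph m → ℝ := fun t θ => coneDensity k θ * (((m : ℝ) + 1) *
    ((h θ + t * z θ) / k θ) ^ m * (z θ / k θ)) with hF'
  have hFd : HasDerivAt (fun t => ∫ θ, F t θ ∂(sphMeasure m)) (∫ θ, F' s θ ∂(sphMeasure m)) s := by
    refine hasDerivAt_integral_of_compactSpace (ε := ε) (fun t _ => ?_) ?_ (fun t _ θ => ?_) hs
    · exact hs'.continuous_coneDensity.mul (((hh.add_smul hz t).continuous_coe_sph.div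
        hs'.continuous_coe_sph fun θ => (hkpos θ).ne').pow _)
    · have c1 := hh.continuous_coe_sph.comp (continuous_snd (X := ℝ))
      have c2 := hz.continuous_coe_sph.comp (continuous_snd (X := ℝ))
      have c3 := hs'.continuous_coe_sph.comp (continuous_snd (X := ℝ))
      have c4 := hs'.continuous_coneDensity.comp (continuous_snd (X := ℝ))
      exact c4.mul ((continuous_const.mul (((c1.add (continuous_fst.mul c2)).div c3
        fun p => (hkpos p.2).ne').pow m)).mul (c2.div c3 fun p => (hkpos p.2).ne'))
    · have h2 : HasDerivAt (fun t => (h θ + t * z θ) / k θ) (z θ / k θ) t := by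
        simpa using (((hasDerivAt_id t).mul_const (z θ)).const_add (h θ)).div_const (k θ)
      exact ((h2.fun_pow (m + 1)).const_mul (coneDensity k θ)).congr_deriv (by simp [hF'])
  have hVd := hasDerivAt_coneVol hh hz hε hs
  -- By `coneVol_le` the volume lies below the comparison integral `∫ F t` and touches it at `t =
  -- s`, so the derivatives agree there. That of `∫ F t` is explicit, since only the factor `((h + t
  -- z) / k) ^ (m + 1)` varies.
  have hmax : IsLocalMax (fun t => (coneVol fun y => h y + t * z y)
      - ∫ θ, F t θ ∂(sphMeasure m)) s := by
    have hnhds : {t : ℝ | |t| < ε} ∈ 𝓝 s := (isOpen_lt continuous_abs continuous_const).mem_nhds hs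
    filter_upwards [hnhds] with t ht
    have h1 := hs'.coneVol_le (hε t ht)
    have h2 : ∫ θ, F s θ ∂(sphMeasure m) = coneVol k := by
      refine integral_congr_ae (ae_of_all _ fun θ => ?_)
      simp only [hF]
      rw [show h θ + s * z θ = k θ from rfl, div_self (hkpos θ).ne']
      simp
    rw [h2, sub_self]
    exact sub_nonpos.mpr h1
  have h0 := hmax.hasDerivAt_eq_zero (hVd.fun_sub hFd)
  rw [sub_eq_zero.mp h0, ← integral_const_mul]
  refine integral_congr_ae (ae_of_all _ fun θ => ?_)
  simp only [hF', coneDensity]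
  rw [show h θ + s * z θ = k θ from rfl, div_self (hkpos θ).ne']
  have := (hkpos θ).ne'
  rw [one_pow]
  field_simp

theorem continuous_detDeriv_right (hh : HomC2 h) (hz : HomC2 z) (t : ℝ) :
    Continuous (detDeriv h z t) :=
  ((((hh.continuous_hessFull.add (hz.continuous_hessStd.const_smul t)).matrix_adjugate).matrix_mul
    hz.continuous_hessStd).matrix_trace :)

/-- Two expressions for the derivative of the volume at 0 are equated: the product rule gives `∫ z
det D²h` plus the left side, and the first variation formula gives `(m + 1) ∫ z det D²h`. -/
theorem IsAdmissible.integral_mul_trace (hh : IsAdmissible h) (hz : HomC2 z) :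
    ∫ θ : Sph m, h θ * ((hessMatrix h θ).det * ((hessMatrix h θ)⁻¹ * hessMatrix z θ).trace)
      ∂(sphMeasure m) = m * ∫ θ : Sph m, z θ * (hessMatrix h θ).det ∂(sphMeasure m) := by
  obtain ⟨ε, hε, hadm⟩ := hh.exists_perturb hz
  have h1 := integral_coneDensityDeriv hh.toHomC2 hz hadm (s := 0) (by simpa using hε)
  have hc1 : Continuous fun θ : Sph m => z θ * (hessMatrix h θ).det :=
    hz.continuous_coe_sph.mul hh.continuous_det_hessMatrix
  have hc2 : Continuous fun θ : Sph m => h θ * detDeriv h z 0 θ :=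
    hh.continuous_coe_sph.mul (continuous_detDeriv_right hh.toHomC2 hz 0)
  have h2 : ∫ θ, coneDensityDeriv h z 0 θ ∂(sphMeasure m)
      = (∫ θ : Sph m, z θ * (hessMatrix h θ).det ∂(sphMeasure m))
        + ∫ θ : Sph m, h θ * detDeriv h z 0 θ ∂(sphMeasure m) := by
    rw [← integral_add (integrable_of_continuous hc1) (integrable_of_continuous hc2)]
    refine integral_congr_ae (ae_of_all _ fun θ => ?_)
    simp only [coneDensityDeriv, zero_smul, zero_mul, add_zero, hh.det_hessFull]
  have h3 : (fun y => h y + 0 * z y) = h := by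
    ext y
    rw [zero_mul, add_zero]
  rw [h3, h2] at h1
  simp only [← detDeriv_zero hh hz]
  generalize (∫ θ : Sph m, h θ * detDeriv h z 0 θ ∂(sphMeasure m)) = I at h1 ⊢
  linarith

theorem hasDerivAt_integral_mul_det {ε : ℝ} (hh : HomC2 h) (hz : HomC2 z)
    (hε : ∀ t, |t| < ε → IsAdmissible fun y => h y + t * z y) {s : ℝ} (hs : |s| < ε) :
    HasDerivAt (fun t => ∫ θ : Sph m, z θ * (hessMatrix (fun y => h y + t * z y) θ).det
      ∂(sphMeasure m)) (∫ θ : Sph m, z θ * detDeriv h z s θ ∂(sphMeasure m)) s := by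
  refine hasDerivAt_integral_of_compactSpace (ε := ε)
    (F := fun t (θ : Sph m) => z θ * (hessMatrix (fun y => h y + t * z y) θ).det)
    (F' := fun t (θ : Sph m) => z θ * detDeriv h z t θ) (fun t _ => ?_) ?_ (fun t ht θ => ?_) hs
  · exact hz.continuous_coe_sph.mul (hh.add_smul hz t).continuous_det_hessMatrix
  · exact (hz.continuous_coe_sph.comp (continuous_snd (X := ℝ))).mul (continuous_detDeriv hh hz)
  · exact (hasDerivAt_det_hessMatrix hh hz (hε t ht) θ).const_mul _

/-- The Brunn--Minkowski inequality in its infinitesimal form. -/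
theorem IsAdmissible.integral_mul_trace_nonpos (hh : IsAdmissible h) (hz : HomC2 z)
    (h0 : ∫ θ : Sph m, z θ * (hessMatrix h θ).det ∂(sphMeasure m) = 0) :
    ∫ θ : Sph m, z θ * ((hessMatrix h θ).det * ((hessMatrix h θ)⁻¹ * hessMatrix z θ).trace)
      ∂(sphMeasure m) ≤ 0 := by
  obtain ⟨ε, hε, hadm⟩ := hh.exists_perturb hz
  have hn : (0 : ℝ) < (m : ℝ) + 1 := by positivity
  have h00 : IsAdmissible fun y => h y + 0 * z y := hadm 0 (by simpa using hε)
  -- The first-variation form of `V'` contains no derivative of the determinant, so one more use of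
  -- Jacobi's formula yields `V''(0)`. The hypothesis `h0` says that `V'(0) = 0`.
  have hV : ∀ t, |t| < ε → HasDerivAt (fun t => coneVol fun y => h y + t * z y)
      (((m : ℝ) + 1) * ∫ θ : Sph m, z θ * (hessMatrix (fun y => h y + t * z y) θ).det
        ∂(sphMeasure m)) t := fun t ht => by
    rw [← integral_coneDensityDeriv hh.toHomC2 hz hadm ht]
    exact hasDerivAt_coneVol hh.toHomC2 hz hadm ht
  have hmax : ∀ t, |t| < ε → (coneVol fun y => h y + t * z y) * (coneVol fun y => h y + -t * z y)
      ≤ (coneVol fun y => h y + 0 * z y) ^ 2 := fun t ht =>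
    coneVol_mul_coneVol_le h00 (hadm t ht) (hadm (-t) (by simpa using ht)) fun y => by ring
  have hU := (hasDerivAt_integral_mul_det hh.toHomC2 hz hadm
    (s := 0) (by simpa using hε)).const_mul ((m : ℝ) + 1)
  have hU0 : ((m : ℝ) + 1) * ∫ θ : Sph m, z θ * (hessMatrix (fun y => h y + 0 * z y) θ).det
      ∂(sphMeasure m) = 0 := by
    simp only [zero_mul, add_zero, h0, mul_zero]
  have key := second_deriv_nonpos (V := fun t => coneVol fun y => h y + t * z y)
    (U := fun t => ((m : ℝ) + 1) * ∫ θ : Sph m, z θ *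
      (hessMatrix (fun y => h y + t * z y) θ).det ∂(sphMeasure m)) hε hV hU hmax h00.coneVol_pos hU0
  simp only [← detDeriv_zero hh hz]
  exact nonpos_of_mul_nonpos_right key hn

end CentroAffine

/-! ### The operator `Δ_K`: Leibniz rule, Green's identity, and the integral inequality -/

namespace CentroAffine

variable {m : ℕ} {h : Euc m → ℝ} {f : Sph m → ℝ}

theorem homExt_coe (f : Sph m → ℝ) (θ : Sph m) : homExt f (θ : Euc m) = f θ := by
  rw [homExt, dif_neg (coe_sph_ne_zero θ)]
  congr 1
  ext1
  simp

theorem homExt_smul (f : Sph m → ℝ) {c : ℝ} (hc : 0 < c) (y : Euc m) :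
    homExt f (c • y) = homExt f y := by
  rcases eq_or_ne y 0 with rfl | hy
  · rw [smul_zero]
  · rw [homExt, homExt, dif_neg hy, dif_neg (smul_ne_zero hc.ne' hy)]
    congr 2
    rw [norm_smul, Real.norm_of_nonneg hc.le, smul_smul, mul_inv, mul_comm c⁻¹, mul_assoc,
      inv_mul_cancel₀ hc.ne', mul_one]

theorem IsC2.contDiffAt_homExt (hf : IsC2 f) {y : Euc m} (hy : y ≠ 0) :
    ContDiffAt ℝ 2 (homExt f) y := by
  have hfact := Fact.mk (finrank_euclideanSpace_fin (𝕜 := ℝ) (n := m + 1))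
  let U : TopologicalSpace.Opens (Euc m) := ⟨{0}ᶜ, isOpen_compl_singleton⟩
  have hU : ∀ x : U, (x : Euc m) ≠ 0 := fun x => x.2
  let ν : U → Euc m := fun x => ‖(x : Euc m)‖⁻¹ • (x : Euc m)
  have hν : ContMDiff 𝓘(ℝ, Euc m) 𝓘(ℝ, Euc m) 2 ν := by
    intro x
    refine contMDiffAt_subtype_iff (f := fun x : Euc m => ‖x‖⁻¹ • x).mpr ?_
    refine ContDiffAt.contMDiffAt ?_
    exact ((contDiffAt_norm ℝ (hU x)).inv (norm_ne_zero_iff.mpr (hU x))).smul contDiffAt_id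
  have hν1 : ∀ x, ν x ∈ sphere (0 : Euc m) 1 := fun x => by
    rw [mem_sphere_zero_iff_norm, norm_smul, norm_inv, norm_norm,
      inv_mul_cancel₀ (norm_ne_zero_iff.mpr (hU x))]
  have h1 : ContMDiff 𝓘(ℝ, Euc m) 𝓘(ℝ, ℝ) 2 fun x : U => f ⟨ν x, hν1 x⟩ :=
    hf.comp (hν.codRestrict_sphere hν1)
  have h2 : (fun x : U => homExt f x) = fun x : U => f ⟨ν x, hν1 x⟩ := by
    ext x
    rw [homExt, dif_neg (hU x)]
  rw [← h2] at h1
  exact (contMDiffAt_subtype_iff.mp (h1 ⟨y, hy⟩)).contDiffAt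

theorem IsC2.of_contDiffAt {F : Euc m → ℝ} (hF : ∀ θ : Sph m, ContDiffAt ℝ 2 F θ) :
    IsC2 fun θ : Sph m => F θ := by
  have hfact := Fact.mk (finrank_euclideanSpace_fin (𝕜 := ℝ) (n := m + 1))
  intro θ
  exact ((hF θ).contMDiffAt).comp θ (contMDiff_coe_sphere (n := m) θ)

theorem IsC2.continuous (hf : IsC2 f) : Continuous f := ContMDiff.continuous hf

theorem IsC2.homC2_mul (hf : IsC2 f) (hh : HomC2 h) : HomC2 fun y => homExt f y * h y where
  contDiffAt y hy := (hf.contDiffAt_homExt hy).mul (hh.contDiffAt y hy)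
  homog c hc y := by rw [homExt_smul f hc, hh.homog c hc]; ring

theorem IsC2.sub_const (hf : IsC2 f) (c : ℝ) : IsC2 fun θ => f θ - c :=
  ContMDiff.sub hf contMDiff_const

theorem IsC2.sq (hf : IsC2 f) : IsC2 fun θ => f θ ^ 2 :=
  ContMDiff.pow hf 2

theorem fderiv_fderiv_mul {u v : Euc m → ℝ} {y : Euc m} (hu : ContDiffAt ℝ 2 u y)
    (hv : ContDiffAt ℝ 2 v y) (a b : Euc m) :
    fderiv ℝ (fderiv ℝ fun x => u x * v x) y a b
      = u y * fderiv ℝ (fderiv ℝ v) y a b + fderiv ℝ u y a * fderiv ℝ v y b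
        + (v y * fderiv ℝ (fderiv ℝ u) y a b + fderiv ℝ v y a * fderiv ℝ u y b) := by
  have hd : ∀ w : Euc m → ℝ, ContDiffAt ℝ 2 w y → ∀ᶠ x in 𝓝 y, DifferentiableAt ℝ w x := by
    intro w hw
    filter_upwards [hw.eventually (by simp)] with x hx
    exact hx.differentiableAt (by norm_num)
  have hdd : ∀ w : Euc m → ℝ, ContDiffAt ℝ 2 w y → DifferentiableAt ℝ (fderiv ℝ w) y :=
    fun w hw => (hw.fderiv_right (m := 1) (by norm_num)).differentiableAt (by norm_num)
  have h1 : (fderiv ℝ fun x => u x * v x) =ᶠ[𝓝 y]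
      fun x => u x • fderiv ℝ v x + v x • fderiv ℝ u x := by
    filter_upwards [hd u hu, hd v hv] with x hx hx'
    exact fderiv_fun_mul hx hx'
  rw [h1.fderiv_eq]
  have hu' := (hd u hu).self_of_nhds
  have hv' := (hd v hv).self_of_nhds
  rw [fderiv_fun_add (hu'.fun_smul (hdd v hv)) (hv'.fun_smul (hdd u hu)),
    fderiv_fun_smul hu' (hdd v hv), fderiv_fun_smul hv' (hdd u hu)]
  simp

/-- Leibniz' rule for `f² h = f · (f h)`. The cross terms `df ⊗ dh` are absorbed into `D²(f h)`,
which leaves a rank-one term in `df`. -/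
theorem hessMatrix_sq_mul (hf : IsC2 f) (hh : HomC2 h) (θ : Sph m) :
    hessMatrix (fun y => homExt (fun θ => f θ ^ 2) y * h y) θ
      = (2 * f θ) • hessMatrix (fun y => homExt f y * h y) θ - (f θ ^ 2) • hessMatrix h θ
        + (2 * h θ) • Matrix.vecMulVec (diffVec f θ) (diffVec f θ) := by
  have h1 : (fun y => homExt (fun θ => f θ ^ 2) y * h y)
      = fun y => homExt f y * (homExt f y * h y) := by
    ext y
    by_cases hy : y = 0
    · simp [homExt, hy]
    · simp only [homExt, dif_neg hy]; ring
  have ha := hf.contDiffAt_homExt (coe_sph_ne_zero θ)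
  have hb := hh.contDiffAt θ (coe_sph_ne_zero θ)
  ext i j
  simp only [h1, hessMatrix, diffVec, Matrix.of_apply, Matrix.add_apply, Matrix.sub_apply,
    Matrix.smul_apply, Matrix.vecMulVec_apply, smul_eq_mul]
  rw [fderiv_fderiv_mul ha (ha.mul hb), fderiv_fderiv_mul ha hb,
    fderiv_fun_mul (ha.differentiableAt (by norm_num)) (hb.differentiableAt (by norm_num)),
    homExt_coe]
  simp only [add_apply, smul_apply, smul_eq_mul]
  ring

theorem homExt_sub_const_mul (hh : HomC2 h) (c : ℝ) :
    (fun y => homExt (fun θ => f θ - c) y * h y)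
      = fun y => homExt f y * h y + (-c) * h y := by
  ext y
  by_cases hy : y = 0
  · simp [homExt, hy, hh.map_zero]
  · simp only [homExt, dif_neg hy]; ring

section Body

variable {K : ConvexBody (Euc m)}

theorem volDensity_eq (hK : IsAdmissible (supportFun K)) :
    volDensity K = coneDensity (supportFun K) := by
  ext θ
  rw [volDensity, hK.abs_det_snoc]
  exact abs_of_pos (hK.coneDensity_pos θ)

theorem volMeasure_eq (hK : IsAdmissible (supportFun K)) : volMeasure K =
    (sphMeasure m).withDensity fun θ => ENNReal.ofReal (coneDensity (supportFun K) θ) := by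
  rw [volMeasure, volDensity_eq hK]

theorem isFiniteMeasure_volMeasure (hK : IsAdmissible (supportFun K)) :
    IsFiniteMeasure (volMeasure K) := by
  rw [volMeasure_eq hK]
  exact isFiniteMeasure_withDensity_ofReal
    (integrable_of_continuous hK.continuous_coneDensity).2

theorem integral_volMeasure (hK : IsAdmissible (supportFun K)) (u : Sph m → ℝ) :
    ∫ θ, u θ ∂(volMeasure K) = ∫ θ, coneDensity (supportFun K) θ * u θ ∂(sphMeasure m) := by
  rw [volMeasure_eq hK, integral_withDensity_eq_integral_toReal_smul
    hK.continuous_coneDensity.measurable.ennreal_ofReal (ae_of_all _ fun _ => ENNReal.ofReal_lt_top)]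
  refine integral_congr_ae (ae_of_all _ fun θ => ?_)
  simp [ENNReal.toReal_ofReal (hK.coneDensity_pos θ).le]

/-- The frame may vary discontinuously, so the trace is written as the quotient of `detDeriv` by the
determinant, both of which are continuous. -/
theorem continuous_laplacian (hK : IsAdmissible (supportFun K)) (hf : IsC2 f) :
    Continuous (laplacian K f) := by
  have hz := hf.homC2_mul hK.toHomC2
  have h1 : laplacian K f = fun θ => detDeriv (supportFun K)
      (fun y => homExt f y * supportFun K y) 0 θ / (hessMatrix (supportFun K) θ).det
      - (m : ℝ) * f θ := by
    ext θ
    rw [laplacian, detDeriv_zero hK hz, mul_div_cancel_left₀ _ (hK.det_hessMatrix_pos θ).ne']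
  rw [h1]
  exact ((continuous_detDeriv_right hK.toHomC2 hz 0).div hK.continuous_det_hessMatrix
    fun θ => (hK.det_hessMatrix_pos θ).ne').sub (continuous_const.mul hf.continuous)

/-- The diffusion property of `Δ_K`. Since `g_K⁻¹ = h (D²h)⁻¹`, the rank-one term of
`hessMatrix_sq_mul` contributes the gradient, and the zeroth-order terms cancel because the identity
matrix has trace `m`. -/
theorem laplacian_sq (hK : IsAdmissible (supportFun K)) (hf : IsC2 f) (θ : Sph m) :
    laplacian K (fun θ => f θ ^ 2) θ = 2 * (f θ * laplacian K f θ) + 2 * gradSq K f θ := by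
  have hA := (hK.det_hessMatrix_pos θ).ne'
  have hu : IsUnit (hessMatrix (supportFun K) θ).det := isUnit_iff_ne_zero.mpr hA
  have hh := (hK.pos θ (coe_sph_ne_zero θ)).ne'
  have hg : gradSq K f θ = supportFun K θ * ((hessMatrix (supportFun K) θ)⁻¹ *
      Matrix.vecMulVec (diffVec f θ) (diffVec f θ)).trace := by
    have h1 : (metric K θ)⁻¹ = supportFun K θ • (hessMatrix (supportFun K) θ)⁻¹ := by
      refine Matrix.inv_eq_right_inv ?_
      rw [metric, Matrix.smul_mul, Matrix.mul_smul, smul_smul, inv_mul_cancel₀ hh, one_smul,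
        Matrix.mul_nonsing_inv _ hu]
    rw [gradSq, h1, Matrix.smul_mulVec, dotProduct_smul, Matrix.mul_vecMulVec,
      Matrix.trace_vecMulVec, smul_eq_mul, dotProduct_comm]
  rw [laplacian, laplacian, hessMatrix_sq_mul hf hK.toHomC2, hg]
  simp only [mul_add, mul_sub, Matrix.mul_smul, Matrix.trace_add, Matrix.trace_sub,
    Matrix.trace_smul, smul_eq_mul, Matrix.nonsing_inv_mul _ hu, Matrix.trace_one, Fintype.card_fin]
  ring

theorem laplacian_sub_const (hK : IsAdmissible (supportFun K)) (hf : IsC2 f) (c : ℝ) (θ : Sph m) :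
    laplacian K (fun θ => f θ - c) θ = laplacian K f θ := by
  have hu : IsUnit (hessMatrix (supportFun K) θ).det :=
    isUnit_iff_ne_zero.mpr (hK.det_hessMatrix_pos θ).ne'
  rw [laplacian, laplacian, homExt_sub_const_mul hK.toHomC2,
    (hf.homC2_mul hK.toHomC2).hessMatrix_add_smul hK.toHomC2]
  simp only [mul_add, Matrix.mul_smul, Matrix.trace_add, Matrix.trace_smul, smul_eq_mul,
    Matrix.nonsing_inv_mul _ hu, Matrix.trace_one, Fintype.card_fin]
  ring

theorem continuous_gradSq (hK : IsAdmissible (supportFun K)) (hf : IsC2 f) :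
    Continuous (gradSq K f) := by
  have h1 : gradSq K f = fun θ =>
      (laplacian K (fun θ => f θ ^ 2) θ - 2 * (f θ * laplacian K f θ)) / 2 := by
    ext θ
    rw [laplacian_sq hK hf]; ring
  rw [h1]
  exact ((continuous_laplacian hK hf.sq).sub (continuous_const.mul
    (hf.continuous.mul (continuous_laplacian hK hf)))).div_const 2

theorem gradSq_nonneg (hK : IsAdmissible (supportFun K)) (θ : Sph m) : 0 ≤ gradSq K f θ := by
  have h1 := (hK.posDef_hessMatrix θ).smul (inv_pos.mpr (hK.pos θ (coe_sph_ne_zero θ)))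
  simpa [gradSq, metric] using h1.inv.posSemidef.dotProduct_mulVec_nonneg (diffVec f θ)

/-- This is `integral_mul_trace` with `z = f h`. -/
theorem integral_laplacian (hK : IsAdmissible (supportFun K)) (hf : IsC2 f) :
    ∫ θ, laplacian K f θ ∂(volMeasure K) = 0 := by
  have hz := hf.homC2_mul hK.toHomC2
  have h1 := hK.integral_mul_trace hz
  have hc1 : Continuous fun θ : Sph m => homExt f θ * supportFun K θ *
      (hessMatrix (supportFun K) θ).det :=
    hz.continuous_coe_sph.mul hK.continuous_det_hessMatrix
  have hc2 : Continuous fun θ : Sph m => supportFun K θ * ((hessMatrix (supportFun K) θ).det *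
      ((hessMatrix (supportFun K) θ)⁻¹ *
        hessMatrix (fun y => homExt f y * supportFun K y) θ).trace) := by
    simp only [← detDeriv_zero hK hz]
    exact hK.continuous_coe_sph.mul (continuous_detDeriv_right hK.toHomC2 hz 0)
  rw [integral_volMeasure hK, ← sub_eq_zero.mpr h1, ← integral_const_mul, ← integral_sub
    (integrable_of_continuous hc2) ((integrable_of_continuous hc1).const_mul _)]
  refine integral_congr_ae (ae_of_all _ fun θ => ?_)
  simp only [coneDensity, laplacian, homExt_coe]
  ring

/-- The Poincaré inequality for `ν_K`: infinitesimal Brunn–Minkowski for `z = f h`, where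
`tr((D²h)⁻¹ D²z) = Δ_K f + m f` and criticality of the volume means that `f` has mean zero. -/
theorem integral_mul_laplacian_le (hK : IsAdmissible (supportFun K)) (hf : IsC2 f)
    (h0 : ∫ θ, f θ ∂(volMeasure K) = 0) :
    ∫ θ, f θ * (laplacian K f θ + m * f θ) ∂(volMeasure K) ≤ 0 := by
  have hz := hf.homC2_mul hK.toHomC2
  rw [integral_volMeasure hK] at h0 ⊢
  refine le_of_eq_of_le ?_ (hK.integral_mul_trace_nonpos hz ?_)
  · refine integral_congr_ae (ae_of_all _ fun θ => ?_)
    simp only [coneDensity, laplacian, homExt_coe]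
    ring
  · rw [← h0]
    refine integral_congr_ae (ae_of_all _ fun θ => ?_)
    simp only [coneDensity, homExt_coe]
    ring

/-- Integrate the formula for `Δ_K(f²)`; its left side has integral zero. -/
theorem integral_gradSq (hK : IsAdmissible (supportFun K)) (hf : IsC2 f) :
    ∫ θ, gradSq K f θ ∂(volMeasure K) = ∫ θ, -laplacian K f θ * f θ ∂(volMeasure K) := by
  have := isFiniteMeasure_volMeasure hK
  have h1 := integral_laplacian hK hf.sq
  have hl := continuous_laplacian hK hf
  simp only [laplacian_sq hK hf] at h1
  have i1 : Integrable (fun θ => f θ * laplacian K f θ) (volMeasure K) :=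
    integrable_of_continuous (hf.continuous.mul hl)
  have i2 : Integrable (gradSq K f) (volMeasure K) :=
    integrable_of_continuous (continuous_gradSq hK hf)
  rw [integral_add (i1.const_mul 2) (i2.const_mul 2),
    integral_const_mul, integral_const_mul] at h1
  simp only [neg_mul, integral_neg, mul_comm (laplacian K f _)]
  linarith

theorem local_brunnMinkowski (hK : IsAdmissible (supportFun K)) (hf : IsC2 f) :
    (m : ℝ) * ∫ θ, gradSq K f θ ∂(volMeasure K) ≤ ∫ θ, laplacian K f θ ^ 2 ∂(volMeasure K) := by
  have := isFiniteMeasure_volMeasure hK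
  have hl := continuous_laplacian hK hf
  set ν := volMeasure K with hν
  obtain ⟨c, hc⟩ : ∃ c : ℝ, ∫ θ, (f θ - c) ∂ν = 0 := by
    rcases eq_or_ne (ν.real Set.univ) 0 with h0 | h0
    · refine ⟨0, ?_⟩
      have : ν = 0 := Measure.measure_univ_eq_zero.mp
        ((ENNReal.toReal_eq_zero_iff _).mp h0 |>.resolve_right (measure_ne_top _ _))
      simp [this]
    · refine ⟨(∫ θ, f θ ∂ν) / ν.real Set.univ, ?_⟩
      rw [integral_sub (integrable_of_continuous hf.continuous) (integrable_const _),
        integral_const, smul_eq_mul, mul_div_cancel₀ _ h0, sub_self]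
  have hg := hf.sub_const c
  set g : Sph m → ℝ := fun θ => f θ - c with hgdef
  have h1 := integral_mul_laplacian_le hK hg hc
  simp only [show laplacian K g = laplacian K f from funext (laplacian_sub_const hK hf c)] at h1
  have i1 : Integrable (fun θ => laplacian K f θ ^ 2) ν := integrable_of_continuous (hl.pow 2)
  have i2 : Integrable (fun θ => g θ * laplacian K f θ) ν :=
    integrable_of_continuous (hg.continuous.mul hl)
  have i3 : Integrable (fun θ => g θ ^ 2) ν := integrable_of_continuous (hg.continuous.pow 2)
  have h2 : ∫ θ, gradSq K f θ ∂ν = -∫ θ, g θ * laplacian K f θ ∂ν := by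
    have e : ∀ θ, g θ * laplacian K f θ = -(-laplacian K f θ * f θ) - c * laplacian K f θ := by
      intro θ; simp only [hgdef]; ring
    have i4 : Integrable (fun θ => -(-laplacian K f θ * f θ)) ν :=
      integrable_of_continuous (hl.neg.mul hf.continuous).neg
    have i5 : Integrable (laplacian K f) ν := integrable_of_continuous hl
    rw [integral_gradSq hK hf, integral_congr_ae (ae_of_all _ e), integral_sub i4
      (i5.const_mul c), integral_neg, integral_const_mul,
      integral_laplacian hK hf]
    ring
  have h3 : ∫ θ, g θ * (laplacian K f θ + m * g θ) ∂ν
      = (∫ θ, g θ * laplacian K f θ ∂ν) + m * ∫ θ, g θ ^ 2 ∂ν := by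
    rw [← integral_const_mul, ← integral_add i2 (i3.const_mul _)]
    exact integral_congr_ae (ae_of_all _ fun θ => by ring)
  -- In the expansion of this square, the Poincaré inequality bounds `m² ∫ g²` by `-m ∫ g Δ_K f`.
  -- What remains is `0 ≤ ∫ (Δ_K f)² + m ∫ g Δ_K f`, the claim by `h2`.
  have h4 : 0 ≤ ∫ θ, (laplacian K f θ + m * g θ) ^ 2 ∂ν := integral_nonneg fun θ => sq_nonneg _
  have h5 : ∫ θ, (laplacian K f θ + m * g θ) ^ 2 ∂ν = (∫ θ, laplacian K f θ ^ 2 ∂ν)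
      + 2 * m * (∫ θ, g θ * laplacian K f θ ∂ν) + (m : ℝ) ^ 2 * ∫ θ, g θ ^ 2 ∂ν := by
    have i12 : Integrable (fun θ => laplacian K f θ ^ 2 + 2 * m * (g θ * laplacian K f θ)) ν :=
      i1.add (i2.const_mul _)
    rw [← integral_const_mul, ← integral_const_mul, ← integral_add i1 (i2.const_mul _),
      ← integral_add i12 (i3.const_mul _)]
    exact integral_congr_ae (ae_of_all _ fun θ => by ring)
  rw [h3] at h1
  rw [h5] at h4
  rw [h2]
  have h6 := mul_le_mul_of_nonneg_left h1 (Nat.cast_nonneg (α := ℝ) m)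
  nlinarith

end Body

end CentroAffine

/-! ### Support functions of smooth strongly convex bodies -/

namespace CentroAffine

variable {m : ℕ} {K : ConvexBody (Euc m)}

section supportFun

theorem bddAbove_inner_image (K : ConvexBody (Euc m)) (y : Euc m) :
    BddAbove ((fun x : Euc m => inner ℝ y x) '' (K : Set (Euc m))) :=
  K.isCompact.bddAbove_image (by fun_prop)

theorem inner_le_supportFun {x : Euc m} (hx : x ∈ (K : Set (Euc m))) (y : Euc m) :
    inner ℝ y x ≤ supportFun K y :=
  le_csSup (bddAbove_inner_image K y) ⟨x, hx, rfl⟩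

theorem exists_inner_eq_supportFun (K : ConvexBody (Euc m)) (y : Euc m) :
    ∃ p ∈ (K : Set (Euc m)), inner ℝ y p = supportFun K y := by
  obtain ⟨p, hp, h⟩ := K.isCompact.exists_sSup_image_eq K.nonempty
    (f := fun x : Euc m => inner ℝ y x) (by fun_prop)
  exact ⟨p, hp, h.symm⟩

theorem supportFun_smul (K : ConvexBody (Euc m)) {c : ℝ} (hc : 0 < c) (y : Euc m) :
    supportFun K (c • y) = c * supportFun K y := by
  obtain ⟨p, hp, h1⟩ := exists_inner_eq_supportFun K y
  obtain ⟨q, hq, h2⟩ := exists_inner_eq_supportFun K (c • y)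
  refine le_antisymm ?_ ?_
  · rw [← h2, real_inner_smul_left]
    exact mul_le_mul_of_nonneg_left (inner_le_supportFun hq y) hc.le
  · rw [← h1, ← real_inner_smul_left]
    exact inner_le_supportFun hp _

theorem supportFun_pos (hK : (0 : Euc m) ∈ interior (K : Set (Euc m))) {y : Euc m} (hy : y ≠ 0) :
    0 < supportFun K y := by
  have h1 : ∀ᶠ t in 𝓝[>] (0 : ℝ), t • y ∈ (K : Set (Euc m)) := by
    have : Tendsto (fun t : ℝ => t • y) (𝓝 0) (𝓝 0) := by
      have h : Continuous fun t : ℝ => t • y := by fun_prop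
      simpa using h.tendsto 0
    exact mem_nhdsWithin_of_mem_nhds (this (mem_interior_iff_mem_nhds.mp hK))
  obtain ⟨t, ht, ht0⟩ := (h1.and self_mem_nhdsWithin).exists
  refine lt_of_lt_of_le ?_ (inner_le_supportFun ht y)
  rw [real_inner_smul_right]
  exact mul_pos ht0 (real_inner_self_pos.mpr hy)

end supportFun

section boundary

variable {U : Set (Euc m)} {φ : Euc m → ℝ} {p y : Euc m}

theorem hasDerivAt_line (hφ : DifferentiableAt ℝ φ p) (v : Euc m) :
    HasDerivAt (fun t : ℝ => φ (p + t • v)) (fderiv ℝ φ p v) 0 := by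
  have h1 : HasDerivAt (fun t : ℝ => p + t • v) v 0 := by
    simpa using ((hasDerivAt_id (0 : ℝ)).smul_const v).const_add p
  have h2 : HasFDerivAt φ (fderiv ℝ φ p) (p + (0 : ℝ) • v) := by simpa using hφ.hasFDerivAt
  exact h2.comp_hasDerivAt 0 h1

theorem eventually_line_mem (hU : IsOpen U) (hp : p ∈ U) (v : Euc m) :
    ∀ᶠ t in 𝓝 (0 : ℝ), p + t • v ∈ U := by
  have h : Continuous fun t : ℝ => p + t • v := by fun_prop
  exact h.tendsto 0 (hU.mem_nhds (by simpa using hp))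

/-- At a contact point of the body with a supporting hyperplane the boundary equation holds, and
the normal is a positive multiple of the gradient. -/
theorem contact_point (hU : IsOpen U) (hKU : (K : Set (Euc m)) ∩ U = {x ∈ U | φ x ≤ 0})
    (hpU : p ∈ U) (hφ : DifferentiableAt ℝ φ p) (hG : gradient φ p ≠ 0) (hy : y ≠ 0)
    (hpK : p ∈ (K : Set (Euc m))) (hmax : inner ℝ y p = supportFun K y) :
    φ p = 0 ∧ 0 < inner ℝ (gradient φ p) y / ‖gradient φ p‖ ^ 2 ∧
      y = (inner ℝ (gradient φ p) y / ‖gradient φ p‖ ^ 2) • gradient φ p := by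
  set G := gradient φ p with hGdef
  have hmem : ∀ x ∈ U, φ x ≤ 0 → inner ℝ y x ≤ inner ℝ y p := by
    intro x hx hx0
    rw [hmax]
    exact inner_le_supportFun (hKU.symm.subset ⟨hx, hx0⟩ : x ∈ (K : Set (Euc m)) ∩ U).1 y
  have hline : ∀ v, (∀ᶠ t in 𝓝[>] (0 : ℝ), φ (p + t • v) ≤ 0) → inner ℝ y v ≤ 0 := by
    intro v hv
    obtain ⟨t, ⟨ht1, ht2⟩, ht0⟩ := ((hv.and (mem_nhdsWithin_of_mem_nhds
      (eventually_line_mem hU hpU v))).and self_mem_nhdsWithin).exists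
    have h1 := hmem _ ht2 ht1
    rw [inner_add_right, real_inner_smul_right] at h1
    have ht0' : (0 : ℝ) < t := ht0
    by_contra! h2
    nlinarith
  have hp0 : φ p ≤ 0 := (hKU.subset ⟨hpK, hpU⟩).2
  have hφp : φ p = 0 := by
    refine le_antisymm hp0 (not_lt.mp fun hlt => ?_)
    have h1 : ∀ᶠ t in 𝓝[>] (0 : ℝ), φ (p + t • y) ≤ 0 := by
      have h2 := (hasDerivAt_line hφ y).continuousAt
      have h3 : ∀ᶠ t in 𝓝 (0 : ℝ), φ (p + t • y) < 0 :=
        h2.eventually (gt_mem_nhds (by simpa using hlt))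
      exact mem_nhdsWithin_of_mem_nhds (h3.mono fun t ht => ht.le)
    exact (hline y h1).not_gt (real_inner_self_pos.mpr hy)
  -- Directions in which `φ` decreases enter `K`, so `⟨y, ·⟩` cannot increase along them. Letting `u
  -- - ε G` tend to `u` extends this to directions orthogonal to `G`.
  have hneg : ∀ v, inner ℝ G v < 0 → inner ℝ y v ≤ 0 := by
    intro v hv
    refine hline v ?_
    rw [hGdef, inner_gradient] at hv
    have h1 := (hasDerivAt_iff_tendsto_slope.mp (hasDerivAt_line hφ v)).eventually (gt_mem_nhds hv)
    have h2 : 𝓝[>] (0 : ℝ) ≤ 𝓝[≠] 0 := nhdsWithin_mono 0 fun t ht => ne_of_gt ht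
    filter_upwards [h2 h1, self_mem_nhdsWithin] with t ht ht0
    rw [slope_def_field] at ht
    simp only [zero_smul, add_zero, hφp, sub_zero] at ht
    have ht0' : (0 : ℝ) < t := ht0
    by_contra! h3
    exact absurd (div_nonneg h3.le ht0'.le) ht.not_ge
  have hG2 : 0 < ‖G‖ ^ 2 := by positivity
  have horth : ∀ u, inner ℝ G u = 0 → inner ℝ y u ≤ 0 := by
    intro u hu
    have h1 : ∀ ε : ℝ, 0 < ε → inner ℝ y u ≤ ε * inner ℝ y G := by
      intro ε hε
      have h2 := hneg (u - ε • G) (by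
        rw [inner_sub_right, hu, real_inner_smul_right, real_inner_self_eq_norm_sq]
        nlinarith)
      rw [inner_sub_right, real_inner_smul_right] at h2
      linarith
    have h3 : Tendsto (fun ε : ℝ => ε * inner ℝ y G) (𝓝[>] 0) (𝓝 0) := by
      have : Continuous fun ε : ℝ => ε * inner ℝ y G := by fun_prop
      have h4 := this.tendsto 0
      rw [zero_mul] at h4
      exact h4.mono_left nhdsWithin_le_nhds
    exact ge_of_tendsto h3 (by filter_upwards [self_mem_nhdsWithin] with ε hε using h1 ε hε)
  set c := inner ℝ G y / ‖G‖ ^ 2 with hc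
  have hu0 : inner ℝ G (y - c • G) = 0 := by
    rw [inner_sub_right, real_inner_smul_right, real_inner_self_eq_norm_sq, hc,
      div_mul_cancel₀ _ hG2.ne', sub_self]
  -- The component `u = y - c G` is orthogonal to `G`, hence `|u|² = ⟨y, u⟩ ≤ 0`.
  have hyc : y = c • G := by
    have h1 : inner ℝ (y - c • G) (y - c • G) ≤ 0 := by
      rw [inner_sub_left, real_inner_smul_left, hu0, mul_zero, sub_zero]
      exact horth _ hu0
    exact sub_eq_zero.mp (inner_self_eq_zero.mp (le_antisymm h1 real_inner_self_nonneg))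
  refine ⟨hφp, lt_of_le_of_ne ?_ ?_, hyc⟩
  · have h1 := hneg (-G) (by rw [inner_neg_right, real_inner_self_eq_norm_sq]; linarith)
    rw [inner_neg_right, real_inner_comm] at h1
    exact div_nonneg (by linarith) hG2.le
  · intro h0
    rw [← h0, zero_smul] at hyc
    exact hy hyc

/-- The segment from `p` to a second contact point would lie in `K` and be tangent to the boundary
at `p`. Along it `φ` starts from 0 with zero slope and positive second derivative, so it becomes
positive near `p`, outside `K`. -/
theorem contact_point_unique (hU : IsOpen U) (hKU : (K : Set (Euc m)) ∩ U = {x ∈ U | φ x ≤ 0})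
    (hpU : p ∈ U) (hφ : ContDiffAt ℝ 2 φ p) (hG : gradient φ p ≠ 0)
    (hpos : ∀ v : Euc m, v ≠ 0 → fderiv ℝ φ p v = 0 → 0 < fderiv ℝ (fderiv ℝ φ) p v v)
    (hy : y ≠ 0) (hpK : p ∈ (K : Set (Euc m))) (hmax : inner ℝ y p = supportFun K y)
    {q : Euc m} (hqK : q ∈ (K : Set (Euc m))) (hmaxq : inner ℝ y q = supportFun K y) : q = p := by
  by_contra hne
  have hd : DifferentiableAt ℝ φ p := hφ.differentiableAt (by norm_num)
  obtain ⟨hφp, hc, hyc⟩ := contact_point hU hKU hpU hd hG hy hpK hmax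
  set v := q - p with hv
  have hv0 : v ≠ 0 := sub_ne_zero.mpr hne
  have hv1 : fderiv ℝ φ p v = 0 := by
    have h1 : inner ℝ y v = 0 := by rw [hv, inner_sub_right, hmax, hmaxq, sub_self]
    rw [hyc, real_inner_smul_left] at h1
    rw [← inner_gradient]
    exact (mul_eq_zero.mp h1).resolve_left hc.ne'
  have hcont : Tendsto (fun t : ℝ => p + t • v) (𝓝 0) (𝓝 p) := by
    have h : Continuous fun t : ℝ => p + t • v := by fun_prop
    simpa using h.tendsto 0
  have hP : ∀ᶠ t in 𝓝 (0 : ℝ), HasDerivAt (fun t : ℝ => φ (p + t • v))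
      (fderiv ℝ φ (p + t • v) v) t := by
    filter_upwards [hcont.eventually (hφ.eventually (by simp))] with t ht
    have h1 : HasDerivAt (fun t : ℝ => p + t • v) v t := by
      simpa using ((hasDerivAt_id t).smul_const v).const_add p
    exact (ht.differentiableAt (by norm_num)).hasFDerivAt.comp_hasDerivAt t h1
  have hQ : HasDerivAt (fun t : ℝ => fderiv ℝ φ (p + t • v) v)
      (fderiv ℝ (fderiv ℝ φ) p v v) 0 := by
    have h1 : HasDerivAt (fun t : ℝ => p + t • v) v 0 := by
      simpa using ((hasDerivAt_id (0 : ℝ)).smul_const v).const_add p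
    have h2 : HasFDerivAt (fderiv ℝ φ) (fderiv ℝ (fderiv ℝ φ) p) (p + (0 : ℝ) • v) := by
      simpa using ((hφ.fderiv_right (m := 1) (by norm_num)).differentiableAt
        (by norm_num)).hasFDerivAt
    exact (ContinuousLinearMap.apply ℝ ℝ v).hasFDerivAt.comp_hasDerivAt (0 : ℝ)
      (h2.comp_hasDerivAt 0 h1)
  have hev := eventually_lt_of_second_deriv_pos hP hQ (by simpa using hv1) (hpos v hv0 hv1)
  obtain ⟨t, ⟨⟨ht1, ht2⟩, ht0⟩⟩ := ((hev.and (mem_nhdsWithin_of_mem_nhds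
    (eventually_line_mem hU hpU v))).and (Ioo_mem_nhdsGT (zero_lt_one (α := ℝ)))).exists
  have hmem : p + t • v ∈ (K : Set (Euc m)) := by
    have := K.convex.add_smul_sub_mem hpK hqK ⟨ht0.1.le, ht0.2.le⟩
    exact this
  have h3 : φ (p + t • v) ≤ 0 := (hKU.subset ⟨hmem, ht2⟩).2
  simp only [zero_smul, add_zero, hφp] at ht1
  linarith

end boundary

/-- The contact points and the multipliers depend smoothly on the normal. -/
theorem exists_contact_map (hK : IsSmoothStronglyConvex K) {y₀ : Euc m} (hy₀ : y₀ ≠ 0) :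
    ∃ (φ : Euc m → ℝ) (P : Euc m → Euc m) (C : Euc m → ℝ),
      ContDiffAt ℝ 1 P y₀ ∧ ContDiffAt ℝ 1 C y₀ ∧ 0 < C y₀ ∧ ContDiffAt ℝ 2 φ (P y₀) ∧
      (∀ v : Euc m, v ≠ 0 → fderiv ℝ φ (P y₀) v = 0 → 0 < fderiv ℝ (fderiv ℝ φ) (P y₀) v v) ∧
      ∀ᶠ y in 𝓝 y₀, P y ∈ (K : Set (Euc m)) ∧ inner ℝ y (P y) = supportFun K y ∧ φ (P y) = 0 ∧
        y = C y • gradient φ (P y) := by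
  obtain ⟨p₀, hp₀, hmax⟩ := exists_inner_eq_supportFun K y₀
  have hfront : p₀ ∈ frontier (K : Set (Euc m)) := by
    refine ⟨subset_closure hp₀, fun hint => ?_⟩
    have h1 : ∀ᶠ t in 𝓝[>] (0 : ℝ), p₀ + t • y₀ ∈ interior (K : Set (Euc m)) :=
      mem_nhdsWithin_of_mem_nhds (eventually_line_mem isOpen_interior hint y₀)
    obtain ⟨t, ht, ht0⟩ := (h1.and self_mem_nhdsWithin).exists
    have h2 := inner_le_supportFun (interior_subset ht) y₀
    rw [inner_add_right, real_inner_smul_right, hmax] at h2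
    have h3 : 0 < t * inner ℝ y₀ y₀ := mul_pos ht0 (real_inner_self_pos.mpr hy₀)
    linarith
  obtain ⟨U, φ, hU, hpU, hφU, hφ', hKU, hpos⟩ := hK.boundary p₀ hfront
  have hφat : ∀ x ∈ U, ContDiffAt ℝ 2 φ x := fun x hx =>
    ((hφU.contDiffAt (hU.mem_nhds hx))).of_le ENat.LEInfty.out
  have hφ₀ := hφat p₀ hpU
  have hG : gradient φ p₀ ≠ 0 := by
    intro h0
    refine hφ' (ContinuousLinearMap.ext fun v => ?_)
    rw [← inner_gradient, h0, inner_zero_left]; rfl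
  obtain ⟨hφp, hc₀, hyc⟩ := contact_point hU hKU hpU (hφ₀.differentiableAt (by norm_num)) hG hy₀
    hp₀ hmax
  let κ : Euc m × Euc m → ℝ := fun q => inner ℝ (gradient φ q.1) q.2 / ‖gradient φ q.1‖ ^ 2
  set c₀ := inner ℝ (gradient φ p₀) y₀ / ‖gradient φ p₀‖ ^ 2 with hc₀def
  -- A contact point `p` with multiplier `c` solves `Ψ (p, c) = (y, 0)`; the inverse function
  -- theorem solves this equation for `(p, c)` near `(p₀, c₀)`.
  let Ψ : Euc m × ℝ → Euc m × ℝ := fun q => (q.2 • gradient φ q.1, φ q.1)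
  have hgrad := hφ₀.contDiffAt_gradient
  have hΨ : ContDiffAt ℝ 1 Ψ (p₀, c₀) := by
    have h1 : ContDiffAt ℝ 1 (fun q : Euc m × ℝ => gradient φ q.1) (p₀, c₀) :=
      ContDiffAt.comp (g := gradient φ) (f := Prod.fst) (p₀, c₀) hgrad contDiffAt_fst
    have h2 : ContDiffAt ℝ 1 (fun q : Euc m × ℝ => φ q.1) (p₀, c₀) :=
      (hφ₀.of_le (by norm_num)).comp (p₀, c₀) contDiffAt_fst
    exact (contDiffAt_snd.smul h1).prodMk h2
  have hderiv : ∀ v s, fderiv ℝ Ψ (p₀, c₀) (v, s)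
      = (c₀ • fderiv ℝ (gradient φ) p₀ v + s • gradient φ p₀, fderiv ℝ φ p₀ v) := by
    intro v s
    have h1 : HasFDerivAt (fun q : Euc m × ℝ => gradient φ q.1)
        ((fderiv ℝ (gradient φ) p₀).comp (ContinuousLinearMap.fst ℝ (Euc m) ℝ)) (p₀, c₀) :=
      HasFDerivAt.comp (g := gradient φ) (f := Prod.fst) (p₀, c₀) (hgrad.differentiableAt (by norm_num)).hasFDerivAt hasFDerivAt_fst
    have h2 : HasFDerivAt (fun q : Euc m × ℝ => φ q.1)
        ((fderiv ℝ φ p₀).comp (ContinuousLinearMap.fst ℝ (Euc m) ℝ)) (p₀, c₀) :=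
      HasFDerivAt.comp (g := φ) (f := Prod.fst) (p₀, c₀) (hφ₀.differentiableAt (by norm_num)).hasFDerivAt hasFDerivAt_fst
    have h3 : HasFDerivAt (fun q : Euc m × ℝ => q.2)
        (ContinuousLinearMap.snd ℝ (Euc m) ℝ) (p₀, c₀) := hasFDerivAt_snd
    have h4 := (h3.fun_smul h1).prodMk h2
    rw [show fderiv ℝ Ψ (p₀, c₀) = _ from h4.fderiv]
    simp
  -- A kernel vector `(v, s)` has `v` tangent to the boundary. Pairing the first component with `v`
  -- gives `c₀ D²φ(v, v) = 0`, so `v = 0`, and then `s = 0`.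
  have hinj : Function.Injective (fderiv ℝ Ψ (p₀, c₀)) := by
    rw [injective_iff_map_eq_zero]
    rintro ⟨v, s⟩ h
    rw [hderiv, Prod.mk_eq_zero] at h
    obtain ⟨h1, h2⟩ := h
    have hv : v = 0 := by
      by_contra hv
      have h3 := hpos v hv h2
      have h4 := congrArg (fun w => inner ℝ w v) h1
      simp only [inner_add_left, real_inner_smul_left, inner_fderiv_gradient hφ₀, inner_gradient,
        h2, inner_zero_left, mul_zero, add_zero] at h4
      exact (mul_pos hc₀ h3).ne' h4
    subst hv
    rw [map_zero, smul_zero, zero_add, smul_eq_zero] at h1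
    rw [h1.resolve_right hG]; rfl
  let A : (Euc m × ℝ) ≃L[ℝ] (Euc m × ℝ) :=
    (LinearEquiv.ofInjectiveEndo (fderiv ℝ Ψ (p₀, c₀)).toLinearMap hinj).toContinuousLinearEquiv
  have hA : HasFDerivAt Ψ (A : Euc m × ℝ →L[ℝ] Euc m × ℝ) (p₀, c₀) := by
    have h1 : (A : Euc m × ℝ →L[ℝ] Euc m × ℝ) = fderiv ℝ Ψ (p₀, c₀) := by
      ext x <;> rfl
    rw [h1]
    exact (hΨ.differentiableAt (by norm_num)).hasFDerivAt
  have hstrict : HasStrictFDerivAt Ψ (A : Euc m × ℝ →L[ℝ] Euc m × ℝ) (p₀, c₀) :=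
    hΨ.hasStrictFDerivAt' hA (by norm_num)
  set g := hΨ.localInverse hA (by norm_num) with hg
  have hgC : ContDiffAt ℝ 1 g (Ψ (p₀, c₀)) := hΨ.to_localInverse hA (by norm_num)
  have hleft : ∀ᶠ q in 𝓝 (p₀, c₀), g (Ψ q) = q := hstrict.eventually_left_inverse
  have hΨ₀ : Ψ (p₀, c₀) = (y₀, 0) := by
    simp only [Ψ, hφp]
    rw [← hyc]
  have hy₀C : ContDiffAt ℝ 1 (fun y : Euc m => g (y, 0)) y₀ := by
    rw [hΨ₀] at hgC
    exact hgC.comp y₀ (contDiffAt_id.prodMk contDiffAt_const)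
  have hκ : ContinuousAt κ (p₀, y₀) := by
    have h1 : ContinuousAt (fun q : Euc m × Euc m => gradient φ q.1) (p₀, y₀) :=
      ContinuousAt.comp (g := gradient φ) (f := Prod.fst) hgrad.continuousAt continuousAt_fst
    exact (h1.inner continuousAt_snd).div (h1.norm.pow 2) (by positivity)
  have hpair : ∀ᶠ q in 𝓝 (p₀, y₀), g (Ψ (q.1, κ q)) = (q.1, κ q) :=
    (continuousAt_fst.prodMk hκ : ContinuousAt (fun q : Euc m × Euc m => (q.1, κ q)) (p₀, y₀))
      |>.eventually hleft
  have hUe : ∀ᶠ x in 𝓝 p₀, x ∈ U := hU.mem_nhds hpU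
  have hne : ∀ᶠ x in 𝓝 p₀, x ∈ U ∧ gradient φ x ≠ 0 :=
    hUe.and (hgrad.continuousAt.eventually_ne hG)
  rw [nhds_prod_eq] at hpair
  obtain ⟨a, ha, b, hb, hab⟩ := eventually_prod_iff.mp hpair
  obtain ⟨W, hWsub, hWo, hpW⟩ := _root_.mem_nhds_iff.mp (ha.and hne)
  have hcomp : IsCompact ((K : Set (Euc m)) \ W) := K.isCompact.diff hWo
  have hsep : ∀ᶠ y in 𝓝 y₀, ∀ x ∈ (K : Set (Euc m)) \ W, inner ℝ y x < inner ℝ y p₀ := by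
    refine hcomp.eventually_forall_of_forall_eventually fun x hx => ?_
    have h1 : inner ℝ y₀ x < inner ℝ y₀ p₀ := by
      refine lt_of_le_of_ne (by rw [hmax]; exact inner_le_supportFun hx.1 y₀) fun heq => ?_
      refine hx.2 ?_
      rw [contact_point_unique hU hKU hpU hφ₀ hG hpos hy₀ hp₀ hmax hx.1 (heq.trans hmax)]
      exact hpW
    have h2 : IsOpen {q : Euc m × Euc m | inner ℝ q.1 q.2 < inner ℝ q.1 p₀} :=
      isOpen_lt (by fun_prop) (by fun_prop)
    exact h2.mem_nhds h1
  have hfinal : ∀ᶠ y in 𝓝 y₀, (g (y, 0)).1 ∈ (K : Set (Euc m)) ∧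
      inner ℝ y (g (y, 0)).1 = supportFun K y ∧ φ (g (y, 0)).1 = 0 ∧
      y = (g (y, 0)).2 • gradient φ (g (y, 0)).1 := by
    filter_upwards [hsep, hb, isOpen_ne.mem_nhds hy₀] with y hy1 hy2 hy3
    obtain ⟨p, hpK, hpm⟩ := exists_inner_eq_supportFun K y
    have hpW : p ∈ W := by
      by_contra hpW
      have h1 := hy1 p ⟨hpK, hpW⟩
      have h2 := inner_le_supportFun hp₀ y
      linarith
    obtain ⟨hpa, hpU', hpG⟩ := hWsub hpW
    obtain ⟨h1, h2, h3⟩ := contact_point hU hKU hpU'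
      ((hφat p hpU').differentiableAt (by norm_num)) hpG hy3 hpK hpm
    have h4 := hab hpa hy2
    have h5 : Ψ (p, κ (p, y)) = (y, 0) := by
      simp only [Ψ, h1, κ]
      rw [← h3]
    simp only at h4
    rw [h5] at h4
    rw [h4]
    exact ⟨hpK, hpm, h1, h3⟩
  have hg₀ : g (y₀, 0) = (p₀, c₀) := by
    rw [← hΨ₀]
    exact hleft.self_of_nhds
  refine ⟨φ, fun y => (g (y, 0)).1, fun y => (g (y, 0)).2, hy₀C.fst, hy₀C.snd, ?_, ?_, ?_, hfinal⟩
  · simpa only [hg₀] using hc₀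
  · simpa only [hg₀] using hφ₀
  · simpa only [hg₀] using hpos

/-- The gradient of `h_K` is the contact point `P(y)`, which is `C¹` in `y`; hence `h_K` is `C²` and
its Hessian is the derivative of `P`. The Hessian inherits positivity from the second fundamental
form by differentiating `y = C(y) ∇φ(P(y))`. -/
theorem isAdmissible_supportFun (hK : IsSmoothStronglyConvex K) : IsAdmissible (supportFun K) := by
  have main : ∀ y₀ : Euc m, y₀ ≠ 0 → ContDiffAt ℝ 2 (supportFun K) y₀ ∧
      ∀ w, inner ℝ y₀ w = 0 → w ≠ 0 → 0 < fderiv ℝ (fderiv ℝ (supportFun K)) y₀ w w := by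
    intro y₀ hy₀
    obtain ⟨φ, P, C, hP, hC, hC₀, hφ, hpos, hev⟩ := exists_contact_map hK hy₀
    have hd : ∀ᶠ y in 𝓝 y₀, HasFDerivAt (supportFun K) (innerSL ℝ (P y)) y := by
      filter_upwards [hev.eventually_nhds, hP.eventually (by simp)] with y hy hPy
      have hPd : DifferentiableAt ℝ P y := hPy.differentiableAt (by norm_num)
      have h1 : DifferentiableAt ℝ (supportFun K) y := by
        have h2 : DifferentiableAt ℝ (fun y => inner ℝ y (P y)) y :=
          differentiableAt_id.inner ℝ hPd
        refine h2.congr_of_eventuallyEq ?_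
        filter_upwards [hy] with x hx using hx.2.1.symm
      have hy' := hy.self_of_nhds
      -- `P(y) ∈ K` makes this difference nonnegative, with value 0 at `y`; vanishing of its
      -- derivative identifies `∇h_K(y)` with `P(y)`.
      have hmin : IsLocalMin (fun x => supportFun K x - inner ℝ (P y) x) y := by
        refine Eventually.of_forall fun x => ?_
        have h3 := inner_le_supportFun hy'.1 x
        change supportFun K y - inner ℝ (P y) y ≤ supportFun K x - inner ℝ (P y) x
        rw [← hy'.2.1, real_inner_comm y, sub_self, real_inner_comm x]
        linarith
      have h4 := hmin.hasFDerivAt_eq_zero (h1.hasFDerivAt.sub (innerSL ℝ (P y)).hasFDerivAt)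
      rw [← sub_eq_zero.mp h4]
      exact h1.hasFDerivAt
    have hfd : fderiv ℝ (supportFun K) =ᶠ[𝓝 y₀] fun y => innerSL ℝ (P y) :=
      hd.mono fun y hy => hy.fderiv
    have hIC : ContDiffAt ℝ 1 (fun y => innerSL ℝ (P y)) y₀ :=
      (innerSL ℝ).contDiff.contDiffAt.comp y₀ hP
    refine ⟨?_, fun w hw hw0 => ?_⟩
    · have := (contDiffAt_succ_iff_hasFDerivAt (n := 1) (f := supportFun K) (x := y₀) (𝕜 := ℝ)).mpr
        ⟨fun y => innerSL ℝ (P y), ⟨_, hd, fun y hy => hy⟩, hIC⟩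
      exact this
    · have hPd := (hP.differentiableAt (by norm_num)).hasFDerivAt
      have hCd := (hC.differentiableAt (by norm_num)).hasFDerivAt
      set v := fderiv ℝ P y₀ w with hv
      have h1 : fderiv ℝ (fderiv ℝ (supportFun K)) y₀ w w = inner ℝ v w := by
        rw [hfd.fderiv_eq]
        have h2 : HasFDerivAt (fun y => innerSL ℝ (P y)) ((innerSL ℝ).comp (fderiv ℝ P y₀)) y₀ :=
          (innerSL ℝ (E := Euc m)).hasFDerivAt.comp y₀ hPd
        rw [h2.fderiv]
        rfl
      have h2 : fderiv ℝ φ (P y₀) v = 0 := by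
        have h3 : HasFDerivAt (fun y => φ (P y)) ((fderiv ℝ φ (P y₀)).comp (fderiv ℝ P y₀)) y₀ :=
          HasFDerivAt.comp y₀ (hφ.differentiableAt (by norm_num)).hasFDerivAt hPd
        have h4 : (fun y => φ (P y)) =ᶠ[𝓝 y₀] fun _ => 0 := hev.mono fun y hy => hy.2.2.1
        have h5 := (h4.hasFDerivAt_iff.mp h3).unique (hasFDerivAt_const 0 y₀)
        exact DFunLike.congr_fun h5 w
      have h3 : w = fderiv ℝ C y₀ w • gradient φ (P y₀)
          + C y₀ • fderiv ℝ (gradient φ) (P y₀) v := by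
        have h4 : HasFDerivAt (fun y => gradient φ (P y))
            ((fderiv ℝ (gradient φ) (P y₀)).comp (fderiv ℝ P y₀)) y₀ :=
          HasFDerivAt.comp y₀
            (hφ.contDiffAt_gradient.differentiableAt (by norm_num)).hasFDerivAt hPd
        have h5 : (fun y => C y • gradient φ (P y)) =ᶠ[𝓝 y₀] fun y => y :=
          hev.mono fun y hy => hy.2.2.2.symm
        have h6 := (h5.hasFDerivAt_iff.mp (hCd.fun_smul h4)).unique (hasFDerivAt_id y₀)
        have h7 := DFunLike.congr_fun h6 w
        simp only [add_apply, smul_apply, ContinuousLinearMap.smulRight_apply,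
          ContinuousLinearMap.comp_apply, ContinuousLinearMap.id_apply] at h7
        exact h7.symm.trans (add_comm _ _)
      -- If `v = 0`, then `h3` makes `w` parallel to `∇φ(P(y₀))`, hence to `y₀`, although `w` is a
      -- nonzero vector orthogonal to `y₀`.
      have hv0 : v ≠ 0 := by
        intro h0
        rw [h0, map_zero, smul_zero, add_zero] at h3
        have h4 := hev.self_of_nhds.2.2.2
        have h5 : w = (fderiv ℝ C y₀ w / C y₀) • y₀ := by
          conv_rhs => rw [h4]
          rw [smul_smul, ← h4, div_mul_cancel₀ _ hC₀.ne']
          exact h3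
        rw [h5, real_inner_smul_right] at hw
        rcases mul_eq_zero.mp hw with h6 | h6
        · rw [h6, zero_smul] at h5
          exact hw0 h5
        · exact hy₀ (inner_self_eq_zero.mp h6)
      rw [h1, real_inner_comm, h3, inner_add_left, real_inner_smul_left, real_inner_smul_left,
        inner_gradient, h2, mul_zero, zero_add, inner_fderiv_gradient hφ]
      exact mul_pos hC₀ (hpos v hv0 h2)
  refine ⟨⟨fun y hy => (main y hy).1, fun c hc y => supportFun_smul K hc y⟩,
    fun y hy => supportFun_pos hK.zero_mem_interior hy, fun θ w hθ hw hw0 => ?_⟩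
  refine (main θ ?_).2 w hw hw0
  rintro rfl
  simp at hθ

end CentroAffine

/-! ### The spectral gap -/

namespace CentroAffine

variable {m : ℕ} {K : ConvexBody (Euc m)}

theorem memLp_of_continuous (hK : IsAdmissible (supportFun K)) {u : Sph m → ℝ}
    (hu : Continuous u) : MemLp u 2 (volMeasure K) := by
  have := isFiniteMeasure_volMeasure hK
  exact hu.memLp_of_hasCompactSupport (HasCompactSupport.of_compactSpace u)

theorem volMeasure_ne_zero (hK : IsAdmissible (supportFun K)) : volMeasure K ≠ 0 := by
  intro h0
  have h1 := integral_volMeasure hK fun _ => (1 : ℝ)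
  rw [h0, integral_zero_measure] at h1
  simp only [mul_one] at h1
  exact hK.coneVol_pos.ne h1

/-- Linear functions, divided by the support function, are eigenfunctions. -/
theorem isEigenvalue_natCast (hK : IsAdmissible (supportFun K)) : IsEigenvalue K (m : ℝ) := by
  set h := supportFun K with hh
  let f : Euc m → Sph m → ℝ := fun v θ => inner ℝ v (θ : Euc m) / h θ
  have hf : ∀ v, IsC2 (f v) := by
    intro v
    refine IsC2.of_contDiffAt (F := fun y => inner ℝ v y / h y) fun θ => ?_
    exact (contDiffAt_const.inner ℝ contDiffAt_id).div (hK.contDiffAt θ (coe_sph_ne_zero θ))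
      (hK.pos θ (coe_sph_ne_zero θ)).ne'
  have hlin : ∀ v, (fun y => homExt (f v) y * h y) = fun y => inner ℝ v y := by
    intro v
    ext y
    rcases eq_or_ne y 0 with rfl | hy
    · simp [homExt]
    · obtain ⟨r, θ, hr, rfl⟩ := exists_eq_smul_coe_sph hy
      rw [homExt_smul _ hr, homExt_coe, hK.homog r hr, real_inner_smul_right]
      have := (hK.pos θ (coe_sph_ne_zero θ)).ne'
      simp only [f]
      field_simp
  -- Multiplied by `h`, the function extends to a linear one with vanishing Hessian, so only the
  -- zeroth-order term of `Δ_K` survives.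
  have hlap : ∀ v θ, laplacian K (f v) θ = -(m * f v θ) := by
    intro v θ
    have h1 : hessMatrix (fun y : Euc m => inner ℝ v y) θ = 0 := by
      have h2 : fderiv ℝ (fun y : Euc m => inner ℝ v y) = fun _ => innerSL ℝ v := by
        ext1 y
        exact (innerSL ℝ v).fderiv
      ext i j
      simp [hessMatrix, h2]
    rw [laplacian, ← hh, hlin, h1]
    simp
  obtain ⟨v, hv⟩ : ∃ v, ¬ (f v =ᵐ[volMeasure K] 0) := by
    by_contra! hall
    have h1 : ∀ᵐ θ ∂(volMeasure K), ∀ i, f (EuclideanSpace.basisFun (Fin (m + 1)) ℝ i) θ = 0 :=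
      ae_all_iff.mpr fun i => hall _
    have := ae_neBot.mpr (volMeasure_ne_zero hK)
    obtain ⟨θ, hθ⟩ := h1.exists
    refine coe_sph_ne_zero θ (PiLp.ext fun i => ?_)
    have h2 := (div_eq_zero_iff.mp (hθ i)).resolve_right (hK.pos θ (coe_sph_ne_zero θ)).ne'
    simpa [EuclideanSpace.inner_single_left] using h2
  refine ⟨f v, memLp_of_continuous hK (hf v).continuous, hv, fun _ => f v, fun _ => hf v, ?_, ?_⟩
  · simp
  · simp [hlap]

/-- A nonzero eigenvalue is at least `n - 1`. -/
theorem IsEigenvalue.le (hK : IsAdmissible (supportFun K)) {lam : ℝ} (h0 : lam ≠ 0)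
    (hlam : IsEigenvalue K lam) : (m : ℝ) ≤ lam := by
  obtain ⟨u, hu, hu0, f, hf, hfu, hlap⟩ := hlam
  set ν := volMeasure K with hν
  have hF : ∀ k, MemLp (f k) 2 ν := fun k => memLp_of_continuous hK (hf k).continuous
  have hG : ∀ k, MemLp (fun θ => -laplacian K (f k) θ) 2 ν := fun k =>
    memLp_of_continuous hK (continuous_laplacian hK (hf k)).neg
  have hlu : MemLp (fun θ => lam * u θ) 2 ν := hu.const_mul lam
  have hFt : Tendsto (fun k => (hF k).toLp) atTop (𝓝 hu.toLp) :=
    (Lp.tendsto_Lp_iff_tendsto_eLpNorm'' _ hF u hu).mpr hfu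
  have hGt : Tendsto (fun k => (hG k).toLp) atTop (𝓝 hlu.toLp) :=
    (Lp.tendsto_Lp_iff_tendsto_eLpNorm'' _ hG _ hlu).mpr hlap
  have hsm : hlu.toLp = lam • hu.toLp := MemLp.toLp_const_smul lam hu
  rw [hsm] at hGt
  have hinner : ∀ {a b : Sph m → ℝ} (ha : MemLp a 2 ν) (hb : MemLp b 2 ν),
      inner ℝ ha.toLp hb.toLp = ∫ θ, a θ * b θ ∂ν := by
    intro a b ha hb
    rw [L2.inner_def]
    refine integral_congr_ae ?_
    filter_upwards [ha.coeFn_toLp, hb.coeFn_toLp] with θ h1 h2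
    rw [h1, h2]
    simp [mul_comm]
  have e1 : ∀ k, inner ℝ (hF k).toLp (hG k).toLp = ∫ θ, gradSq K (f k) θ ∂ν := by
    intro k
    rw [hinner, integral_gradSq hK (hf k)]
    exact integral_congr_ae (ae_of_all _ fun θ => mul_comm _ _)
  have e2 : ∀ k, inner ℝ (hG k).toLp (hG k).toLp = ∫ θ, laplacian K (f k) θ ^ 2 ∂ν := by
    intro k
    rw [hinner]
    refine integral_congr_ae (ae_of_all _ fun θ => by ring)
  have t1 := hFt.inner (𝕜 := ℝ) hGt
  have t2 := hGt.inner (𝕜 := ℝ) hGt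
  -- Both integral inequalities are statements about `L²` inner products of `f_k` and `-Δ_K f_k`, so
  -- they survive the limit as `0 ≤ λ |u|²` and `m λ |u|² ≤ λ² |u|²`.
  have l1 : 0 ≤ inner ℝ hu.toLp (lam • hu.toLp) :=
    ge_of_tendsto' t1 fun k => by
      rw [e1]
      exact integral_nonneg fun θ => gradSq_nonneg hK θ
  have l2 : (m : ℝ) * inner ℝ hu.toLp (lam • hu.toLp)
      ≤ inner ℝ (lam • hu.toLp) (lam • hu.toLp) :=
    le_of_tendsto_of_tendsto' (t1.const_mul (m : ℝ)) t2 fun k => by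
      rw [e1, e2]
      exact local_brunnMinkowski hK (hf k)
  have hpos : 0 < inner ℝ hu.toLp hu.toLp := by
    refine real_inner_self_pos.mpr fun h => hu0 ?_
    exact (MemLp.toLp_eq_toLp_iff hu MemLp.zero').mp h
  simp only [real_inner_smul_left, real_inner_smul_right] at l1 l2
  have hl : 0 < lam := lt_of_le_of_ne (nonneg_of_mul_nonneg_left l1 hpos) h0.symm
  have h3 : (m : ℝ) * (lam * inner ℝ hu.toLp hu.toLp) ≤ lam * (lam * inner ℝ hu.toLp hu.toLp) := l2
  exact le_of_mul_le_mul_right h3 (mul_pos hl hpos)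

end CentroAffine

theorem theorem5p3 (m : ℕ) (K : ConvexBody (CentroAffine.Euc m))
    (hK : CentroAffine.IsSmoothStronglyConvex K) :
    (∀ f : CentroAffine.Sph m → ℝ, CentroAffine.IsC2 f →
      Integrable (fun θ => CentroAffine.laplacian K f θ ^ 2) (CentroAffine.volMeasure K) ∧
      Integrable (fun θ => CentroAffine.gradSq K f θ) (CentroAffine.volMeasure K) ∧
      Integrable (fun θ => -CentroAffine.laplacian K f θ * f θ) (CentroAffine.volMeasure K) ∧
      (m : ℝ) * ∫ θ, CentroAffine.gradSq K f θ ∂(CentroAffine.volMeasure K)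
        ≤ ∫ θ, CentroAffine.laplacian K f θ ^ 2 ∂(CentroAffine.volMeasure K) ∧
      ∫ θ, CentroAffine.gradSq K f θ ∂(CentroAffine.volMeasure K)
        = ∫ θ, -CentroAffine.laplacian K f θ * f θ ∂(CentroAffine.volMeasure K)) ∧
    (1 ≤ m → (m : ℝ) ≤ CentroAffine.firstEigenvalue K) := by
  have hA := CentroAffine.isAdmissible_supportFun hK
  have := CentroAffine.isFiniteMeasure_volMeasure hA
  refine ⟨fun f hf => ?_, fun hm => ?_⟩
  · have hl := CentroAffine.continuous_laplacian hA hf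
    exact ⟨CentroAffine.integrable_of_continuous (hl.pow 2),
      CentroAffine.integrable_of_continuous (CentroAffine.continuous_gradSq hA hf),
      CentroAffine.integrable_of_continuous (hl.neg.mul hf.continuous),
      CentroAffine.local_brunnMinkowski hA hf, CentroAffine.integral_gradSq hA hf⟩
  -- The infimum of an empty set of reals is 0 by convention, so a nonzero eigenvalue must be
  -- exhibited; `m` is one because `1 ≤ m`.
  · refine le_csInf ⟨(m : ℝ), ?_, CentroAffine.isEigenvalue_natCast hA⟩ fun lam hlam =>
      CentroAffine.IsEigenvalue.le hA hlam.1 hlam.2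
    exact_mod_cast Nat.one_le_iff_ne_zero.mp hm
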